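/- **Notation.** $\hat f(\xi)=\int_{\mathbb R} e^{-ix\xi}f(x)\,\mathrm dx$ is the Fourier(–Plancherel) transform on $L^2(\mathbb R)=L^2(\mathbb R,\mathbb C)$; $L^2_+=\{f\in L^2(\mathbb R): \hat f=0 \text{ a.e. on }(-\infty,0)\}$ is the Hardy space, $H^1_+=L^2_+\cap H^1(\mathbb R)$, and $\Pi:L^2(\mathbb R)\to L^2_+$, $\widehat{\Pi f}=\mathbf 1_{[0,\infty)}\hat f$, is the Szegő projector. For an integer $N\ge 1$, $\mathcal U_N\subset L^2(\mathbb R)$ is the set of $N$-solitons, that is, of functions $$u(x)=\sum_{j=1}^N \mathcal R_{c_j}(x-x_j),\qquad \mathcal R_c(x)=\frac{2c}{1+c^2x^2},\qquad c_j>0,\ x_j\in\mathbb R.$$ For $u\in L^2(\mathbb R)$, the Lax operator $L_u$ is the unbounded operator on $L^2_+$ with domain $H^1_+$ given by $L_u h=-i\,\partial_x h-\Pi(uh)$ (self-adjoint when $u$ is real-valued), and $\mathscr H_{\mathrm{pp}}(L_u)\subset L^2_+$ is its pure point subspace, i.e. the closed linear span of its eigenvectors. For $\eta\ge0$ let $S(\eta)^*f=\Pi(e^{-i\eta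 x}f)$ on $L^2_+$ (the adjoint of multiplication by $e^{i\eta x}$), and let $G$ be the unbounded operator on $L^2_+$ such that $-iG$ is the infinitesimal generator of the semigroup $(S(\eta)^*)_{\eta\ge 0}$: $$Gf=i\lim_{\eta\to0^+}\frac{S(\eta)^*f-f}{\eta},$$ with domain the set of all $f\in L^2_+$ for which this limit exists in $L^2_+$. **Theorem (spectral characterization of the multisoliton manifold).** Let $N\ge1$ and $u\in L^2(\mathbb R)$. Then $u\in\mathcal U_N$ if and only if $u\in L^2(\mathbb R,(1+x^2)\,\mathrm dx)$, $u$ is real-valued (a.e.), $\dim_{\mathbb C}\mathscr H_{\mathrm{pp}}(L_u)=N$ and $\Pi u\in\mathscr H_{\mathrm{pp}}(L_u)$. Moreover, if $u\in\mathcal U_N$, then $\mathscr H_{\mathrm{pp}}(L_u)$ is contained in the domain of $G$ and is invariant under $G$; the function $Q(x)=\det\bigl(x-G|_{\mathscr H_{\mathrm{pp}}(L_u)}\bigr)$ has no zero on $\mathbb R$, and $$\Pi u(x)=i\,\frac{Q'(x)}{Q(x)}\qquad\text{for almost every }x\in\mathbb R,$$ that is, for every $x\in\mathbb R$ when $\Pi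 u$ denotes its continuous representative. -/

import Mathlib

open MeasureTheory Filter Topology FourierTransform LineDeriv SchwartzMap
open scoped ENNReal ContDiff

noncomputable section

namespace BenjaminOno

/-- The complex Hilbert space `L²(ℝ) = L²(ℝ, ℂ)` for Lebesgue measure. -/
abbrev L2 : Type := Lp ℂ 2 (volume : Measure ℝ)

/-! ## Solitons -/

/-- The soliton profile `R(x) = 2 / (1 + x²)`. -/
def profile (x : ℝ) : ℝ := 2 / (1 + x ^ 2)

/-- The rescaled profile `R_c(x) = c R(c x)`. -/
def scaledProfile (c x : ℝ) : ℝ := c * profile (c * x)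

/-- The set `U_N` of `N`-solitons `u(x) = ∑ⱼ R_{cⱼ}(x - xⱼ)`, with all `cⱼ > 0`, as a subset
of `L²(ℝ)`. -/
def multiSolitons (N : ℕ) : Set L2 :=
  {u | ∃ c y : Fin N → ℝ, (∀ j, 0 < c j) ∧
    (u : ℝ → ℂ) =ᵐ[volume] fun x => ((∑ j, scaledProfile (c j) (x - y j) : ℝ) : ℂ)}

/-- The weighted measure `(1 + x²) dx` on `ℝ`. -/
def weightedMeasure : Measure ℝ :=
  volume.withDensity fun x => ENNReal.ofReal (1 + x ^ 2)

/-! ## Hardy space and the Szegő projector -/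

/-- The Hardy space `L²₊` : the square integrable functions whose Fourier transform vanishes on
the negative half-line. -/
def hardy : Submodule ℂ L2 where
  carrier := {f | ∀ᵐ ξ : ℝ, ξ < 0 → (𝓕 f : L2) ξ = 0}
  zero_mem' := by
    have h : (𝓕 (0 : L2) : L2) = 0 := (Lp.fourierTransformₗᵢ ℝ ℂ).map_zero
    simp only [Set.mem_ofPred_eq, h]
    filter_upwards with ξ _
    simp
  add_mem' := by
    intro f g hf hg
    simp only [Set.mem_ofPred_eq] at hf hg ⊢
    rw [FourierAdd.fourier_add]
    filter_upwards [hf, hg, Lp.coeFn_add (𝓕 f : L2) (𝓕 g : L2)] with ξ h1 h2 h3 h0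
    rw [h3, Pi.add_apply, h1 h0, h2 h0, add_zero]
  smul_mem' := by
    intro a f hf
    simp only [Set.mem_ofPred_eq] at hf ⊢
    rw [FourierSMul.fourier_smul]
    filter_upwards [hf, Lp.coeFn_smul a (𝓕 f : L2)] with ξ h1 h3 h0
    rw [h3, Pi.smul_apply, h1 h0, smul_zero]

/-- Multiplication by a bounded measurable function, as an operator on `L²(ℝ)`. -/
def mulBounded (m : ℝ → ℂ) (hm : MemLp m ∞ (volume : Measure ℝ)) : L2 →L[ℂ] L2 :=
  (ContinuousLinearMap.mul ℂ ℂ).holderL volume ∞ 2 2 (hm.toLp m)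

theorem mulBounded_coeFn (m : ℝ → ℂ) (hm : MemLp m ∞ (volume : Measure ℝ)) (f : L2) :
    (mulBounded m hm f : ℝ → ℂ) =ᵐ[volume] fun x => m x * f x := by
  have h : (mulBounded m hm f : ℝ → ℂ) =ᵐ[volume] fun x => (hm.toLp m) x * f x :=
    (ContinuousLinearMap.mul ℂ ℂ).coeFn_holder (hm.toLp m) f
  filter_upwards [h, hm.coeFn_toLp] with x h1 h2
  rw [h1, h2]

theorem memLp_indicator_Ici :
    MemLp ((Set.Ici (0 : ℝ)).indicator fun _ => (1 : ℂ)) ∞ (volume : Measure ℝ) :=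
  (memLp_top_const (1 : ℂ)).indicator measurableSet_Ici

/-- Multiplication by the indicator function of `[0, ∞)` on `L²(ℝ)`. -/
def cutoff : L2 →L[ℂ] L2 := mulBounded _ memLp_indicator_Ici

theorem cutoff_coeFn (f : L2) :
    (cutoff f : ℝ → ℂ) =ᵐ[volume] (Set.Ici (0 : ℝ)).indicator f := by
  filter_upwards [mulBounded_coeFn _ memLp_indicator_Ici f] with x h
  rw [cutoff, h]
  by_cases hx : x ∈ Set.Ici (0 : ℝ) <;> simp [hx]

/-- The Szegő projector `Π : L²(ℝ) → L²₊`, the Fourier multiplier with symbol the indicator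
function of `[0, ∞)`. -/
def szego : L2 →L[ℂ] hardy :=
  ContinuousLinearMap.codRestrict
    (((Lp.fourierTransformₗᵢ ℝ ℂ).symm.toContinuousLinearEquiv : L2 →L[ℂ] L2) ∘L cutoff ∘L
      ((Lp.fourierTransformₗᵢ ℝ ℂ).toContinuousLinearEquiv : L2 →L[ℂ] L2)) hardy
    (by
      intro f
      have h : (𝓕 ((Lp.fourierTransformₗᵢ ℝ ℂ).symm
          (cutoff (Lp.fourierTransformₗᵢ ℝ ℂ f))) : L2)
          = cutoff (Lp.fourierTransformₗᵢ ℝ ℂ f) :=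
        (Lp.fourierTransformₗᵢ ℝ ℂ).apply_symm_apply _
      change ∀ᵐ ξ : ℝ, ξ < 0 → (𝓕 ((Lp.fourierTransformₗᵢ ℝ ℂ).symm
          (cutoff (Lp.fourierTransformₗᵢ ℝ ℂ f))) : L2) ξ = 0
      rw [h]
      filter_upwards [cutoff_coeFn (Lp.fourierTransformₗᵢ ℝ ℂ f)] with ξ h1 h0
      rw [h1]
      simp [h0])

theorem szego_apply (f : L2) : (szego f : L2) = 𝓕⁻ (cutoff (𝓕 f)) := rfl

/-! ## The Sobolev space `H¹₊` -/

/-- `H¹₊ = L²₊ ∩ H¹(ℝ)`, as a subspace of `L²₊`. -/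
def hardySobolev : Submodule ℂ hardy where
  carrier := {h | TemperedDistribution.MemSobolev 1 2
    (Lp.toTemperedDistribution (h : L2))}
  zero_mem' := by
    have h : Lp.toTemperedDistribution (0 : L2) = 0 :=
      (Lp.toTemperedDistributionCLM ℂ (volume : Measure ℝ) 2).map_zero
    simp only [Set.mem_ofPred_eq, ZeroMemClass.coe_zero, h]
    exact TemperedDistribution.memSobolev_fun_zero _ _ _ _
  add_mem' := by
    intro f g hf hg
    have h : Lp.toTemperedDistribution ((f : L2) + (g : L2)) = _ :=
      (Lp.toTemperedDistributionCLM ℂ (volume : Measure ℝ) 2).map_add f g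
    simp only [Set.mem_ofPred_eq, Submodule.coe_add, h] at hf hg ⊢
    exact hf.add hg
  smul_mem' := by
    intro a f hf
    have h : Lp.toTemperedDistribution (a • (f : L2)) = _ :=
      (Lp.toTemperedDistributionCLM ℂ (volume : Measure ℝ) 2).map_smul a f
    simp only [Set.mem_ofPred_eq, Submodule.coe_smul, h] at hf ⊢
    exact hf.smul a

theorem toTemperedDistribution_injective :
    Function.Injective (Lp.toTemperedDistribution : L2 → 𝓢'(ℝ, ℂ)) :=
  LinearMap.ker_eq_bot.mp (Lp.ker_toTemperedDistributionCLM_eq_bot (F := ℂ)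
    (μ := (volume : Measure ℝ)) (p := 2))

/-- Locally integrable functions which define the same functional on test functions agree. -/
theorem ae_eq_of_schwartz {f g : ℝ → ℂ} (hf : LocallyIntegrable f volume)
    (hg : LocallyIntegrable g volume)
    (h : ∀ φ : 𝓢(ℝ, ℂ), HasCompactSupport φ → ∫ x, φ x • f x = ∫ x, φ x • g x) :
    f =ᵐ[volume] g := by
  refine ae_eq_of_integral_contDiff_smul_eq hf hg fun φ φs φc => ?_
  have h1 : HasCompactSupport (Complex.ofRealCLM ∘ φ) := φc.comp_left rfl
  have h2 : ContDiff ℝ ∞ (Complex.ofRealCLM ∘ φ) := by fun_prop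
  have := h (h1.toSchwartzMap h2) h1
  simpa using this

/-- The `L²` function `-i ∂ₓ h` (distributional derivative) exists for `h ∈ H¹`. -/
theorem exists_momentum (h : hardySobolev) : ∃ g : L2, Lp.toTemperedDistribution g =
    (-Complex.I) • ∂_{(1 : ℝ)} (Lp.toTemperedDistribution ((h : hardy) : L2)) := by
  have h1 := (TemperedDistribution.MemSobolev.lineDerivOp (m := (1 : ℝ)) h.2).smul (-Complex.I)
  rw [sub_self, TemperedDistribution.memSobolev_zero_iff] at h1
  obtain ⟨g, hg⟩ := h1
  exact ⟨g, hg.symm⟩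

theorem momentum_fourier {g h : L2} (hgh : Lp.toTemperedDistribution g =
    (-Complex.I) • ∂_{(1 : ℝ)} (Lp.toTemperedDistribution h)) :
    ((𝓕 g : L2) : ℝ → ℂ) =ᵐ[volume] fun ξ => ((2 * Real.pi * ξ : ℝ) : ℂ) * (𝓕 h : L2) ξ := by
  have hloc (f : L2) : LocallyIntegrable f volume :=
    (Lp.memLp f).locallyIntegrable (by norm_num)
  refine ae_eq_of_schwartz (hloc _) ?_ ?_
  · have hc : Continuous fun ξ : ℝ => ((2 * Real.pi * ξ : ℝ) : ℂ) := by fun_prop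
    exact (hloc _).continuous_mul hc
  · intro φ _
    have h1 : 𝓕 (Lp.toTemperedDistribution g) φ =
        𝓕 ((-Complex.I) • ∂_{(1 : ℝ)} (Lp.toTemperedDistribution h)) φ := by rw [hgh]
    have hT : (fun x : ℝ => ((inner ℝ x (1 : ℝ) : ℝ) : ℂ)).HasTemperateGrowth := by fun_prop
    rw [FourierSMul.fourier_smul, TemperedDistribution.fourier_lineDerivOp_eq,
      Lp.fourier_toTemperedDistribution_eq, Lp.fourier_toTemperedDistribution_eq,
      Lp.toTemperedDistribution_apply, smul_smul, smul_apply,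
      TemperedDistribution.smulLeftCLM_apply_apply, Lp.toTemperedDistribution_apply] at h1
    rw [h1, ← integral_smul]
    refine integral_congr_ae (.of_forall fun x => ?_)
    simp only [SchwartzMap.smulLeftCLM_apply_apply hT, smul_eq_mul]
    have hin : inner ℝ x (1 : ℝ) = x := by simp
    rw [hin]
    push_cast
    linear_combination (-2 * (Real.pi : ℂ) * x * φ x * (𝓕 h : L2) x) * Complex.I_sq

theorem momentum_mem (h : hardySobolev) : (exists_momentum h).choose ∈ hardy := by
  have h2 : ∀ᵐ ξ : ℝ, ξ < 0 → (𝓕 ((h : hardy) : L2) : L2) ξ = 0 := (h : hardy).2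
  change ∀ᵐ ξ : ℝ, ξ < 0 → (𝓕 (exists_momentum h).choose : L2) ξ = 0
  filter_upwards [momentum_fourier (exists_momentum h).choose_spec, h2] with ξ h1 h2 h0
  rw [h1, h2 h0, mul_zero]

/-- The operator `D h = -i ∂ₓ h` on `L²₊`, with domain `H¹₊`. -/
def momentum : hardySobolev →ₗ[ℂ] hardy where
  toFun h := ⟨(exists_momentum h).choose, momentum_mem h⟩
  map_add' f g := by
    apply Subtype.ext
    apply toTemperedDistribution_injective
    have h (a b : L2) : Lp.toTemperedDistribution (a + b) =
        Lp.toTemperedDistribution a + Lp.toTemperedDistribution b :=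
      (Lp.toTemperedDistributionCLM ℂ (volume : Measure ℝ) 2).map_add a b
    simp only [Submodule.coe_add]
    rw [(exists_momentum (f + g)).choose_spec, h, (exists_momentum f).choose_spec,
      (exists_momentum g).choose_spec, ← smul_add, ← lineDerivOp_add, ← h]
    rfl
  map_smul' a f := by
    apply Subtype.ext
    apply toTemperedDistribution_injective
    have h (b : L2) : Lp.toTemperedDistribution (a • b) =
        a • Lp.toTemperedDistribution b :=
      (Lp.toTemperedDistributionCLM ℂ (volume : Measure ℝ) 2).map_smul a b
    simp only [Submodule.coe_smul, RingHom.id_apply]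
    rw [(exists_momentum (a • f)).choose_spec, h, (exists_momentum f).choose_spec,
      smul_comm a, ← lineDerivOp_smul (1 : ℝ) a, ← h]
    rfl

theorem momentum_spec (h : hardySobolev) : Lp.toTemperedDistribution (momentum h : L2) =
    (-Complex.I) • ∂_{(1 : ℝ)} (Lp.toTemperedDistribution ((h : hardy) : L2)) :=
  (exists_momentum h).choose_spec

/-- Elements of `H¹₊` are bounded. -/
theorem hardySobolev_memLp_top (h : hardySobolev) :
    MemLp ((h : hardy) : L2) ∞ (volume : Measure ℝ) := by
  obtain ⟨v, hv⟩ := TemperedDistribution.MemSobolev.fourier_memL1 (by simp) h.2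
  have hvi : Integrable v volume := L1.integrable_coeFn v
  have hcont : Continuous (𝓕⁻ (v : ℝ → ℂ)) :=
    VectorFourier.fourierIntegral_continuous Real.continuous_fourierChar
      (by fun_prop) hvi
  have hbd (x : ℝ) : ‖𝓕⁻ (v : ℝ → ℂ) x‖ ≤ ∫ y, ‖v y‖ :=
    VectorFourier.norm_fourierIntegral_le_integral_norm _ _ _ _ _
  have hae : (((h : hardy) : L2) : ℝ → ℂ) =ᵐ[volume] 𝓕⁻ (v : ℝ → ℂ) := by
    refine ae_eq_of_schwartz ((Lp.memLp _).locallyIntegrable (by norm_num))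
      hcont.locallyIntegrable fun φ _ => ?_
    have h1 := congrArg (fun T : 𝓢'(ℝ, ℂ) => T (𝓕⁻ φ)) hv
    simp only [TemperedDistribution.fourier_apply, fourier_fourierInv_eq,
      Lp.toTemperedDistribution_apply] at h1
    rw [h1]
    have h2 := VectorFourier.integral_fourierIntegral_smul_eq_flip (μ := volume) (ν := volume)
      (L := -innerₗ ℝ) (e := Real.fourierChar) (f := φ) (g := v) Real.continuous_fourierChar
      (by fun_prop) φ.integrable hvi
    have h3 : (-innerₗ ℝ).flip = -innerₗ ℝ := by
      ext; simp
    rw [h3] at h2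
    rw [SchwartzMap.fourierInv_coe]
    exact h2
  exact (memLp_congr_ae hae).2 (memLp_top_of_bound hcont.aestronglyMeasurable _ (.of_forall hbd))

/-! ## The Lax operator -/

theorem memLp_mul (u : L2) (h : hardySobolev) :
    MemLp (fun x => u x * ((h : hardy) : L2) x) 2 (volume : Measure ℝ) :=
  (hardySobolev_memLp_top h).mul (Lp.memLp u)

/-- The product `h ↦ u h`, from `H¹₊` to `L²(ℝ)`. -/
def symbolMul (u : L2) : hardySobolev →ₗ[ℂ] L2 where
  toFun h := (memLp_mul u h).toLp _
  map_add' f g := by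
    rw [← MemLp.toLp_add]
    apply MemLp.toLp_congr
    filter_upwards [Lp.coeFn_add ((f : hardy) : L2) ((g : hardy) : L2)] with x hx
    simp only [Submodule.coe_add, Pi.add_apply] at hx ⊢
    rw [hx, mul_add]
  map_smul' a f := by
    simp only [RingHom.id_apply]
    rw [← MemLp.toLp_const_smul]
    apply MemLp.toLp_congr
    filter_upwards [Lp.coeFn_smul a ((f : hardy) : L2)] with x hx
    simp only [Submodule.coe_smul, Pi.smul_apply, smul_eq_mul] at hx ⊢
    rw [hx]
    ring

/-- The Toeplitz operator `T_u h = Π (u h)` on `H¹₊`. -/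
def toeplitz (u : L2) : hardySobolev →ₗ[ℂ] hardy := szego.toLinearMap ∘ₗ symbolMul u

/-- The Lax operator `L_u = D - T_u`, an unbounded operator on `L²₊` with domain `H¹₊`. -/
def lax (u : L2) : hardy →ₗ.[ℂ] hardy where
  domain := hardySobolev
  toFun := momentum - toeplitz u

/-- The pure point subspace of an unbounded operator: the closed linear span of all of its
eigenvectors. -/
def purePoint (A : hardy →ₗ.[ℂ] hardy) : Submodule ℂ hardy :=
  (Submodule.span ℂ
    {φ : hardy | ∃ (μ : ℂ) (x : A.domain), (x : hardy) = φ ∧ A x = μ • φ}).topologicalClosure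

/-! ## The shift semigroup and its generator -/

theorem memLp_exp (η : ℝ) :
    MemLp (fun x : ℝ => Complex.exp (-(Complex.I * η * x))) ∞ (volume : Measure ℝ) := by
  refine memLp_top_of_bound (by fun_prop) 1 (.of_forall fun x => ?_)
  rw [Complex.norm_exp]
  simp

/-- The adjoint `S(η)* f = Π (e^{-iηx} f)` of the shift `S(η) f = e^{iηx} f` on `L²₊`. -/
def shiftAdjoint (η : ℝ) : hardy →L[ℂ] hardy :=
  szego ∘L mulBounded _ (memLp_exp η) ∘L hardy.subtypeL

/-- `g` is the right derivative at `η = 0` of the orbit `η ↦ S(η)* f`. -/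
def HasShiftDeriv (f g : hardy) : Prop :=
  Tendsto (fun η : ℝ => ((η⁻¹ : ℝ) : ℂ) • (shiftAdjoint η f - f)) (𝓝[>] 0) (𝓝 g)

theorem HasShiftDeriv.add {f₁ f₂ g₁ g₂ : hardy} (h₁ : HasShiftDeriv f₁ g₁)
    (h₂ : HasShiftDeriv f₂ g₂) : HasShiftDeriv (f₁ + f₂) (g₁ + g₂) := by
  refine (Tendsto.add h₁ h₂).congr fun η => ?_
  rw [map_add, ← smul_add]
  congr 1
  abel

theorem HasShiftDeriv.smul {f g : hardy} (h : HasShiftDeriv f g) (a : ℂ) :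
    HasShiftDeriv (a • f) (a • g) := by
  refine (Tendsto.const_smul h a).congr fun η => ?_
  rw [map_smul, ← smul_sub, smul_comm]

/-- The domain of the generator: all `f` whose orbit under `S(η)*` has a right derivative at
`η = 0` in `L²₊`. -/
def generatorDomain : Submodule ℂ hardy where
  carrier := {f | ∃ g, HasShiftDeriv f g}
  zero_mem' := ⟨0, by simp [HasShiftDeriv]⟩
  add_mem' := fun ⟨g₁, h₁⟩ ⟨g₂, h₂⟩ => ⟨g₁ + g₂, h₁.add h₂⟩
  smul_mem' := fun a _ ⟨g, h⟩ => ⟨a • g, h.smul a⟩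

/-- The operator `G f = i (d/dη) S(η)* f` at `η = 0⁺`, so that `-i G` is the infinitesimal
generator of the semigroup `S(η)*`. -/
def generator : hardy →ₗ.[ℂ] hardy where
  domain := generatorDomain
  toFun :=
    { toFun := fun f => Complex.I • f.2.choose
      map_add' := fun f g => by
        rw [← smul_add]
        congr 1
        exact tendsto_nhds_unique (f + g).2.choose_spec
          (HasShiftDeriv.add f.2.choose_spec g.2.choose_spec)
      map_smul' := fun a f => by
        rw [RingHom.id_apply, smul_comm]
        congr 1
        exact tendsto_nhds_unique (a • f).2.choose_spec
          (HasShiftDeriv.smul f.2.choose_spec a) }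

/-- The restriction of an unbounded operator `A` to a subspace `M` of its domain with
`A M ⊆ M`. -/
def restrictTo (A : hardy →ₗ.[ℂ] hardy) (M : Submodule ℂ hardy) (hd : M ≤ A.domain)
    (hM : ∀ f : M, A ⟨f, hd f.2⟩ ∈ M) : M →ₗ[ℂ] M :=
  LinearMap.codRestrict M (A.toFun ∘ₗ Submodule.inclusion hd) hM

end BenjaminOno

/-!
The pure point subspace `V = H_pp(L_u)` carries two structures. Let `G` denote the generator of
`S(η)*`; on the functions considered here it is multiplication by `x` up to an additive constant
(`MulRel.generator_eq`). A finite-dimensional subspace of the Hardy space that is stable under `G`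
consists of the proper fractions `A / Q` whose denominator is the characteristic polynomial `Q` of
`G` on it, and the roots of `Q` lie in the open lower half-plane (`exists_generator_ratioSpace`).
The other structure is the Lax operator.

*From the spectral conditions to solitons.* Let `φ` be an eigenvector of `L_u` with eigenvalue
`l`. An energy identity for `φ`, on the Fourier side, shows that `l` cannot be nonnegative, and that
`φ` vanishes as soon as `∫ u φ = 0` (`eigenfunction_eq_zero`); this uses that `x u` is square
integrable. For `l < 0`, the function `g = x φ - const` belongs to `H¹₊`, and the commutator of `x`
and `L_u` gives `(L_u - l) g = -i φ + c Π u` (`exists_mulRel_eigenfunction`). If `Π u ∈ V`, the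
right side belongs to `V`, so the component of `g` orthogonal to `V` is an eigenvector orthogonal
to all eigenvectors, and hence vanishes. Thus `V` is stable under `G`, and it is the space of proper
fractions `A / Q`. Applying `L_u` to `1 / Q` and comparing the terms with denominator `Q²` yields
`Π u = i Q' / Q` (`szego_eq_of_laxInvariant`). Decomposing into simple fractions, `u = 2 Re Π u` is
a sum of solitons, one for each root of `Q` (`mem_multiSolitons_iff`).

*From solitons to the spectral conditions.* If `u = 2 Re (i Q' / Q)`, then `Π u = i Q' / Q` belongs
to the space `W` of proper fractions with denominator `Q`, which has dimension `deg Q`. Since the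
double poles cancel, `L_u` maps `W` to itself (`laxInvariant_ratioSpace`), so that `W` is spanned by
eigenvectors. Conversely, the component orthogonal to `W` of an eigenvector is an eigenvector `b`
with `∫ u b = ⟪Π u, b⟫ = 0`, which vanishes by the energy identity. Hence `W` is the pure point
subspace (`LaxInvariant.purePoint_eq`).
-/

namespace BenjaminOno

/-! ### The Fourier transform of square integrable functions -/

theorem locallyIntegrable_L2 (f : L2) : LocallyIntegrable f volume :=
  (Lp.memLp f).locallyIntegrable (by norm_num)

theorem integral_schwartz_mul_fourier (f : L2) (φ : 𝓢(ℝ, ℂ)) :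
    ∫ ξ, φ ξ * (𝓕 f : L2) ξ = ∫ x, 𝓕 (φ : ℝ → ℂ) x * f x := by
  have h := congrArg (fun T : 𝓢'(ℝ, ℂ) => T φ) (Lp.fourier_toTemperedDistribution_eq f)
  simp only [TemperedDistribution.fourier_apply, Lp.toTemperedDistribution_apply, smul_eq_mul,
    SchwartzMap.fourier_coe] at h
  exact h.symm

theorem integral_schwartz_mul_fourierInv (f : L2) (φ : 𝓢(ℝ, ℂ)) :
    ∫ ξ, φ ξ * (𝓕⁻ f : L2) ξ = ∫ x, 𝓕⁻ (φ : ℝ → ℂ) x * f x := by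
  have h := congrArg (fun T : 𝓢'(ℝ, ℂ) => T φ) (Lp.fourierInv_toTemperedDistribution_eq f)
  simp only [TemperedDistribution.fourierInv_apply, Lp.toTemperedDistribution_apply, smul_eq_mul,
    SchwartzMap.fourierInv_coe] at h
  exact h.symm

/-- On `L¹ ∩ L²` the Fourier–Plancherel transform is given by the Fourier integral. -/
theorem fourier_toLp {g : ℝ → ℂ} (h1 : Integrable g) (h2 : MemLp g 2) :
    ((𝓕 (h2.toLp g) : L2) : ℝ → ℂ) =ᵐ[volume] 𝓕 g := by
  have hcont : Continuous (𝓕 g) :=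
    VectorFourier.fourierIntegral_continuous Real.continuous_fourierChar (by fun_prop) h1
  refine ae_eq_of_schwartz (locallyIntegrable_L2 _) hcont.locallyIntegrable fun φ _ => ?_
  have h3 := VectorFourier.integral_fourierIntegral_smul_eq_flip (μ := volume) (ν := volume)
    (L := innerₗ ℝ) (e := Real.fourierChar) (f := φ) (g := g) Real.continuous_fourierChar
    (by fun_prop) φ.integrable h1
  have h4 : (innerₗ ℝ).flip = innerₗ ℝ := by ext; simp
  rw [h4] at h3
  simp only [smul_eq_mul]
  rw [integral_schwartz_mul_fourier]
  refine Eq.trans (integral_congr_ae ?_) h3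
  filter_upwards [h2.coeFn_toLp] with x hx
  rw [hx]
  rfl

/-- On `L¹ ∩ L²` the inverse Fourier–Plancherel transform is given by the Fourier integral. -/
theorem fourierInv_toLp {g : ℝ → ℂ} (h1 : Integrable g) (h2 : MemLp g 2) :
    ((𝓕⁻ (h2.toLp g) : L2) : ℝ → ℂ) =ᵐ[volume] 𝓕⁻ g := by
  have hcont : Continuous (𝓕⁻ g) :=
    VectorFourier.fourierIntegral_continuous Real.continuous_fourierChar (by fun_prop) h1
  refine ae_eq_of_schwartz (locallyIntegrable_L2 _) hcont.locallyIntegrable fun φ _ => ?_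
  have h3 := VectorFourier.integral_fourierIntegral_smul_eq_flip (μ := volume) (ν := volume)
    (L := -innerₗ ℝ) (e := Real.fourierChar) (f := φ) (g := g) Real.continuous_fourierChar
    (by fun_prop) φ.integrable h1
  have h4 : (-innerₗ ℝ).flip = -innerₗ ℝ := by ext; simp
  rw [h4] at h3
  simp only [smul_eq_mul]
  rw [integral_schwartz_mul_fourierInv]
  refine Eq.trans (integral_congr_ae ?_) h3
  filter_upwards [h2.coeFn_toLp] with x hx
  rw [hx]
  rfl

/-- Modulation becomes translation under the Fourier transform. -/
theorem fourier_modulation {f g : L2} (a : ℝ)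
    (hg : (g : ℝ → ℂ) =ᵐ[volume] fun x => Complex.exp (2 * Real.pi * a * x * Complex.I) * f x) :
    ((𝓕 g : L2) : ℝ → ℂ) =ᵐ[volume] fun ξ => (𝓕 f : L2) (ξ - a) := by
  have hmp : MeasurePreserving (fun ξ : ℝ => ξ - a) volume volume :=
    measurePreserving_sub_right volume a
  have hloc : LocallyIntegrable (fun ξ => (𝓕 f : L2) (ξ - a)) volume :=
    ((Lp.memLp (𝓕 f : L2)).comp_measurePreserving hmp).locallyIntegrable (by norm_num)
  refine ae_eq_of_schwartz (locallyIntegrable_L2 _) hloc fun φ _ => ?_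
  simp only [smul_eq_mul]
  have h1 : ∫ ξ, φ ξ * (𝓕 f : L2) (ξ - a) = ∫ ξ, φ (ξ + a) * (𝓕 f : L2) ξ := by
    rw [← integral_add_right_eq_self _ a]
    simp
  have h0 : ∀ y, φ.compSubConstCLM ℂ (-a) y = φ (y + a) := fun y => by
    change φ (y - -a) = _
    rw [sub_neg_eq_add]
  have h2 : ∀ x, 𝓕 (φ.compSubConstCLM ℂ (-a) : ℝ → ℂ) x =
      Complex.exp (2 * Real.pi * a * x * Complex.I) * 𝓕 (φ : ℝ → ℂ) x := by
    intro x
    rw [Real.fourier_real_eq_integral_exp_smul, Real.fourier_real_eq_integral_exp_smul,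
      ← integral_const_mul, ← integral_sub_right_eq_self _ a]
    refine integral_congr_ae (.of_forall fun y => ?_)
    simp only [h0, sub_add_cancel, smul_eq_mul]
    rw [← mul_assoc, ← Complex.exp_add]
    congr 2
    push_cast
    ring
  rw [h1, integral_schwartz_mul_fourier]
  clear h1
  have h3 := integral_schwartz_mul_fourier f (φ.compSubConstCLM ℂ (-a))
  simp only [h0] at h3
  rw [h3]
  refine integral_congr_ae ?_
  filter_upwards [hg] with x hx
  rw [hx]
  rw [h2]
  ring

theorem fourier_star {f g : L2} (hg : (g : ℝ → ℂ) =ᵐ[volume] fun x => star (f x)) :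
    ((𝓕 g : L2) : ℝ → ℂ) =ᵐ[volume] fun ξ => star ((𝓕 f : L2) (-ξ)) := by
  have hmp : MeasurePreserving (fun ξ : ℝ => -ξ) volume volume :=
    Measure.measurePreserving_neg volume
  have hloc : LocallyIntegrable (fun ξ => star ((𝓕 f : L2) (-ξ))) volume :=
    ((Lp.memLp (𝓕 f : L2)).comp_measurePreserving hmp).star.locallyIntegrable (by norm_num)
  refine ae_eq_of_integral_contDiff_smul_eq (locallyIntegrable_L2 _) hloc fun φ φs φc => ?_
  have h1 : HasCompactSupport (Complex.ofRealCLM ∘ φ) := φc.comp_left rfl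
  have h2 : ContDiff ℝ ∞ (Complex.ofRealCLM ∘ φ) := by fun_prop
  have h3 : HasCompactSupport (Complex.ofRealCLM ∘ fun x => φ (-x)) :=
    HasCompactSupport.comp_left (φc.comp_homeomorph (Homeomorph.neg ℝ)) rfl
  have h4 : ContDiff ℝ ∞ (Complex.ofRealCLM ∘ fun x => φ (-x)) := by fun_prop
  have e1 := integral_schwartz_mul_fourier g (h1.toSchwartzMap h2)
  have e2 := integral_schwartz_mul_fourier f (h3.toSchwartzMap h4)
  simp only [HasCompactSupport.toSchwartzMap_toFun, Function.comp_apply,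
    Complex.ofRealCLM_apply] at e1 e2
  simp only [Complex.real_smul]
  rw [e1]
  have h5 : ∫ x, (φ x : ℂ) * star ((𝓕 f : L2) (-x)) =
      star (∫ x, (φ (-x) : ℂ) * (𝓕 f : L2) x) := by
    rw [← integral_neg_eq_self]
    simp only [neg_neg, Complex.star_def]
    rw [← integral_conj]
    simp
  rw [h5, e2, Complex.star_def, ← integral_conj]
  refine integral_congr_ae ?_
  filter_upwards [hg] with x hx
  rw [hx, map_mul, Complex.star_def]
  congr 1
  rw [Real.fourier_real_eq_integral_exp_smul, Real.fourier_real_eq_integral_exp_smul,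
    ← integral_conj, ← integral_neg_eq_self]
  refine integral_congr_ae (.of_forall fun y => ?_)
  simp [← Complex.exp_conj, Complex.conj_ofNat]

/-! ### The Hardy space and its orthogonal complement -/

theorem fourier_szego (f : L2) :
    ((𝓕 (szego f : L2) : L2) : ℝ → ℂ) =ᵐ[volume] (Set.Ici (0 : ℝ)).indicator (𝓕 f : L2) := by
  rw [szego_apply, fourier_fourierInv_eq]
  exact cutoff_coeFn _

theorem eq_of_fourier_ae_eq {f g : L2} (h : ((𝓕 f : L2) : ℝ → ℂ) =ᵐ[volume] (𝓕 g : L2)) :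
    f = g :=
  (Lp.fourierTransformₗᵢ ℝ ℂ).injective (Lp.ext h)

theorem ae_lt_or_gt : ∀ᵐ ξ : ℝ, ξ < 0 ∨ 0 < ξ := by
  filter_upwards [compl_mem_ae_iff.2 (measure_singleton (0 : ℝ))] with ξ hξ
  exact lt_or_gt_of_ne hξ

theorem szego_coe (f : hardy) : szego (f : L2) = f := by
  apply Subtype.ext
  apply eq_of_fourier_ae_eq
  have h : ∀ᵐ ξ : ℝ, ξ < 0 → (𝓕 (f : L2) : L2) ξ = 0 := f.2
  filter_upwards [fourier_szego (f : L2), h] with ξ h1 h2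
  rw [h1]
  by_cases hξ : ξ < 0
  · simp [hξ, h2 hξ]
  · simp [not_lt.1 hξ]

/-- An `L²` function is annihilated by `Π` when its Fourier transform vanishes on the
positive half-line. -/
theorem szego_eq_zero {f : L2} (h : ∀ᵐ ξ : ℝ, 0 < ξ → (𝓕 f : L2) ξ = 0) : szego f = 0 := by
  apply Subtype.ext
  apply eq_of_fourier_ae_eq
  have h0 : (𝓕 (0 : L2) : L2) = 0 := (Lp.fourierTransformₗᵢ ℝ ℂ).map_zero
  rw [ZeroMemClass.coe_zero, h0]
  filter_upwards [fourier_szego f, h, ae_lt_or_gt, Lp.coeFn_zero ℂ 2 (volume : Measure ℝ)]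
    with ξ h1 h2 h3 h4
  rw [h1, h4]
  rcases h3 with h3 | h3
  · simp [h3]
  · simp [h2 h3]

theorem szego_fourier_of_pos (f : L2) :
    ∀ᵐ ξ : ℝ, 0 < ξ → (𝓕 (szego f : L2) : L2) ξ = (𝓕 f : L2) ξ := by
  filter_upwards [fourier_szego f] with ξ h h0
  rw [h]
  simp [h0.le]

/-- `Π` is the orthogonal projection onto the Hardy space. -/
theorem inner_szego (g : hardy) (f : L2) :
    inner ℂ (g : L2) (szego f : L2) = inner ℂ (g : L2) f := by
  rw [← Lp.inner_fourier_eq (g : L2) f, ← Lp.inner_fourier_eq,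
    L2.inner_def, L2.inner_def]
  refine integral_congr_ae ?_
  have h : ∀ᵐ ξ : ℝ, ξ < 0 → (𝓕 (g : L2) : L2) ξ = 0 := g.2
  filter_upwards [fourier_szego f, h] with ξ h1 h2
  rw [h1]
  by_cases hξ : ξ < 0
  · simp [hξ, h2 hξ]
  · simp [not_lt.1 hξ]

theorem inner_szego_left (g : hardy) (f : L2) :
    inner ℂ (szego f : L2) (g : L2) = inner ℂ f (g : L2) := by
  rw [← inner_conj_symm, inner_szego, inner_conj_symm]

/-- The Hardy space is the orthogonal complement of the kernel of `Π`. -/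
theorem mem_hardy_of_inner {f : L2} (h : ∀ g : L2, szego g = 0 → inner ℂ g f = 0) :
    f ∈ hardy := by
  have h1 : szego (f - szego f) = 0 := by rw [map_sub, szego_coe, sub_self]
  have h2 := h _ h1
  have h3 : inner ℂ (f - (szego f : L2)) (szego f : L2) = 0 := by
    rw [← inner_szego_left, h1, ZeroMemClass.coe_zero, inner_zero_left]
  have h4 : inner ℂ (f - (szego f : L2)) (f - (szego f : L2)) = (0 : ℂ) := by
    rw [inner_sub_right, h2, h3, sub_zero]
  rw [inner_self_eq_zero, sub_eq_zero] at h4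
  rw [h4]
  exact (szego f).2

/-- Complex conjugation maps the Hardy space into the kernel of `Π`. -/
theorem szego_star (f : hardy) : szego (star (f : L2)) = 0 := by
  have h1 : ((star (f : L2) : L2) : ℝ → ℂ) =ᵐ[volume] fun x => star ((f : L2) x) :=
    Lp.coeFn_star (f : L2)
  apply szego_eq_zero
  have h2 : ∀ᵐ ξ : ℝ, ξ < 0 → (𝓕 (f : L2) : L2) ξ = 0 := f.2
  have h3 := (Measure.measurePreserving_neg (volume : Measure ℝ)).quasiMeasurePreserving.ae h2
  filter_upwards [fourier_star h1, h3] with ξ h4 h5 h0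
  rw [h4, h5 (by simpa using h0), star_zero]

theorem mem_hardy_star {f : L2} (hf : szego f = 0) : star f ∈ hardy := by
  have h1 : ((star f : L2) : ℝ → ℂ) =ᵐ[volume] fun x => star (f x) := Lp.coeFn_star f
  have h2 := szego_fourier_of_pos f
  have h0 : (𝓕 (0 : L2) : L2) = 0 := (Lp.fourierTransformₗᵢ ℝ ℂ).map_zero
  rw [hf, ZeroMemClass.coe_zero, h0] at h2
  have h2' : ∀ᵐ ξ : ℝ, 0 < ξ → (𝓕 f : L2) ξ = 0 := by
    filter_upwards [h2, Lp.coeFn_zero ℂ 2 (volume : Measure ℝ)] with ξ h3 h4 h5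
    rw [← h3 h5, h4]
    rfl
  have h3 := (Measure.measurePreserving_neg (volume : Measure ℝ)).quasiMeasurePreserving.ae h2'
  change ∀ᵐ ξ : ℝ, ξ < 0 → (𝓕 (star f : L2) : L2) ξ = 0
  filter_upwards [fourier_star h1, h3] with ξ h4 h5 h6
  rw [h4, h5 (by simpa using h6), star_zero]

theorem star_add_L2 (f g : L2) : star (f + g) = star f + star g := by
  apply Lp.ext
  filter_upwards [Lp.coeFn_star (f + g), Lp.coeFn_star f, Lp.coeFn_star g, Lp.coeFn_add f g,
    Lp.coeFn_add (star f) (star g)] with x h1 h2 h3 h4 h5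
  rw [h1, h5, Pi.star_apply, h4, Pi.add_apply, Pi.add_apply, h2, h3, Pi.star_apply, Pi.star_apply,
    star_add]

/-- A real function is the sum of its Szegő projection and of the conjugate of the latter. -/
theorem eq_szego_add_star {u : L2} (hu : ∀ᵐ x : ℝ, (u x).im = 0) :
    u = (szego u : L2) + star (szego u : L2) := by
  have hs : star u = u := by
    apply Lp.ext
    filter_upwards [Lp.coeFn_star u, hu] with x h1 h2
    rw [h1, Pi.star_apply, Complex.star_def, Complex.conj_eq_iff_im.2 h2]
  have h1 : szego (u - szego u) = 0 := by rw [map_sub, szego_coe, sub_self]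
  have h2 := congrArg szego (show u = star (szego u : L2) + star (u - (szego u : L2)) by
    rw [← star_add_L2, add_sub_cancel, hs])
  rw [map_add, szego_star, zero_add] at h2
  have h3 := szego_coe ⟨_, mem_hardy_star h1⟩
  have h4 : (szego u : L2) = star (u - (szego u : L2)) := by
    conv_lhs => rw [h2]
    exact congrArg Subtype.val h3
  conv_rhs => rw [show star (szego u : L2) = u - (szego u : L2) by
    conv_lhs => rw [h4]
    rw [star_star]]
  rw [add_sub_cancel]

/-- The Hardy space is stable under multiplication by `e^{iηx}` with `η ≥ 0`. -/
theorem exp_mul_mem_hardy {f g : L2} (hf : f ∈ hardy) {η : ℝ} (hη : 0 ≤ η)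
    (hg : (g : ℝ → ℂ) =ᵐ[volume] fun x => Complex.exp (η * x * Complex.I) * f x) :
    g ∈ hardy := by
  have h1 : (g : ℝ → ℂ) =ᵐ[volume] fun x =>
      Complex.exp (2 * Real.pi * (η / (2 * Real.pi) : ℝ) * x * Complex.I) * f x := by
    filter_upwards [hg] with x hx
    rw [hx]
    congr 4
    push_cast
    have : (Real.pi : ℂ) ≠ 0 := by exact_mod_cast Real.pi_ne_zero
    field_simp
  have h2 : ∀ᵐ ξ : ℝ, ξ < 0 → (𝓕 f : L2) ξ = 0 := hf
  have h3 := (measurePreserving_sub_right (volume : Measure ℝ)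
    (η / (2 * Real.pi))).quasiMeasurePreserving.ae h2
  change ∀ᵐ ξ : ℝ, ξ < 0 → (𝓕 g : L2) ξ = 0
  filter_upwards [fourier_modulation _ h1, h3] with ξ h4 h5 h6
  have : 0 ≤ η / (2 * Real.pi) := by positivity
  rw [h4, h5 (by linarith)]

theorem ofReal_sub_ne_zero {p : ℂ} (hp : p.im ≠ 0) (x : ℝ) : (x : ℂ) - p ≠ 0 := by
  intro h
  apply hp
  have := congrArg Complex.im h
  simpa using this

theorem memLp_top_inv_sub {p : ℂ} (hp : p.im ≠ 0) :
    MemLp (fun x : ℝ => ((x : ℂ) - p)⁻¹) ∞ (volume : Measure ℝ) := by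
  have hc : Continuous fun x : ℝ => ((x : ℂ) - p)⁻¹ :=
    Continuous.inv₀ (by fun_prop) (ofReal_sub_ne_zero hp)
  refine memLp_top_of_bound hc.aestronglyMeasurable |p.im|⁻¹ (.of_forall fun x => ?_)
  rw [norm_inv]
  refine inv_anti₀ (abs_pos.2 hp) ?_
  have := Complex.abs_im_le_norm ((x : ℂ) - p)
  simpa using this

theorem inv_sub_eq_integral {p : ℂ} (hp : p.im < 0) (x : ℝ) :
    ((x : ℂ) - p)⁻¹ =
      -Complex.I * ∫ η : ℝ in Set.Ioi 0, Complex.exp ((Complex.I * (x - p)) * η) := by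
  have h : (Complex.I * ((x : ℂ) - p)).re < 0 := by simp [hp]
  rw [integral_exp_mul_complex_Ioi h]
  have h1 := ofReal_sub_ne_zero hp.ne x
  simp only [Complex.ofReal_zero, mul_zero, Complex.exp_zero]
  field_simp

/-- The Hardy space is stable under multiplication by `1 / (x - p)` when `Im p < 0`, since the
latter function is a superposition of the exponentials `e^{iηx}` with `η ≥ 0`. -/
theorem inv_sub_mul_mem_hardy {f g : L2} (hf : f ∈ hardy) {p : ℂ} (hp : p.im < 0)
    (hg : (g : ℝ → ℂ) =ᵐ[volume] fun x => ((x : ℂ) - p)⁻¹ * f x) : g ∈ hardy := by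
  refine mem_hardy_of_inner fun k hk => ?_
  rw [L2.inner_def]
  have h1 : ∫ x, inner ℂ (k x) (g x) = ∫ x, ∫ η : ℝ in Set.Ioi 0,
      inner ℂ (k x) (f x) * (-Complex.I * Complex.exp ((Complex.I * (x - p)) * η)) := by
    refine integral_congr_ae ?_
    filter_upwards [hg] with x hx
    rw [integral_const_mul, integral_const_mul, ← inv_sub_eq_integral hp, hx,
      RCLike.inner_apply, RCLike.inner_apply]
    ring
  rw [h1, integral_integral_swap]
  · refine integral_eq_zero_of_ae ?_
    filter_upwards [ae_restrict_mem measurableSet_Ioi] with η hη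
    have hb : MemLp (fun x : ℝ => Complex.exp (η * x * Complex.I)) ∞ (volume : Measure ℝ) := by
      refine memLp_top_of_bound (by fun_prop) 1 (.of_forall fun x => ?_)
      rw [Complex.norm_exp]
      simp
    have h2 := exp_mul_mem_hardy hf (le_of_lt hη) (mulBounded_coeFn _ hb f)
    have h3 := inner_szego_left ⟨_, h2⟩ k
    rw [hk, ZeroMemClass.coe_zero, inner_zero_left] at h3
    simp only [L2.inner_def] at h3
    have h4 : ∫ x, inner ℂ (k x) (f x) *
        (-Complex.I * Complex.exp ((Complex.I * (x - p)) * η)) =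
        (-Complex.I * Complex.exp (-(Complex.I * p * η))) *
          ∫ x, inner ℂ (k x) (mulBounded _ hb f x) := by
      rw [← integral_const_mul]
      refine integral_congr_ae ?_
      filter_upwards [mulBounded_coeFn _ hb f] with x hx
      rw [hx, RCLike.inner_apply, RCLike.inner_apply,
        show (Complex.I * (x - p)) * (η : ℂ) = -(Complex.I * p * η) + η * x * Complex.I by ring,
        Complex.exp_add]
      ring
    rw [h4, ← h3, mul_zero]
    rfl
  · have hi : Integrable (fun x => inner ℂ (k x) (f x)) := L2.integrable_inner k f
    have he : Integrable (fun η : ℝ => Real.exp (p.im * η))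
        (volume.restrict (Set.Ioi 0)) := integrableOn_exp_mul_Ioi hp 0
    refine (hi.norm.mul_prod he).mono' ?_ ?_
    · exact (hi.aestronglyMeasurable.comp_fst).mul
        (Continuous.aestronglyMeasurable (by fun_prop))
    · refine .of_forall fun z => ?_
      rw [Function.uncurry_apply_pair, norm_mul, norm_mul, Complex.norm_exp]
      simp

/-! ### Sobolev regularity and the Lax operator -/

theorem memSobolev_of_fourier {f g : L2}
    (h : ((𝓕 g : L2) : ℝ → ℂ) =ᵐ[volume] fun ξ => ((2 * Real.pi * ξ : ℝ) : ℂ) * (𝓕 f : L2) ξ) :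
    TemperedDistribution.MemSobolev 1 2 (Lp.toTemperedDistribution f) := by
  rw [TemperedDistribution.memSobolev_iff_exists_smulLeftCLM_fourier]
  have hc : Continuous fun ξ : ℝ => (((1 + ‖ξ‖ ^ 2) ^ ((1 : ℝ) / 2) : ℝ) : ℂ) := by
    refine Complex.continuous_ofReal.comp (Continuous.rpow_const (by fun_prop) fun x => ?_)
    right
    norm_num
  have hm : MemLp (fun ξ : ℝ => (((1 + ‖ξ‖ ^ 2) ^ ((1 : ℝ) / 2) : ℝ) : ℂ) * (𝓕 f : L2) ξ) 2
      volume := by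
    refine MemLp.mono' (g := fun ξ => ‖(𝓕 f : L2) ξ‖ + ‖(𝓕 g : L2) ξ‖)
      ((Lp.memLp (𝓕 f : L2)).norm.add (Lp.memLp (𝓕 g : L2)).norm)
      (hc.aestronglyMeasurable.mul (Lp.aestronglyMeasurable _)) ?_
    filter_upwards [h] with ξ hξ
    have hn : ‖2 * Real.pi * ξ‖ = 2 * Real.pi * |ξ| := by
      rw [Real.norm_eq_abs, abs_mul, abs_of_pos Real.two_pi_pos]
    have hr : (1 + ‖ξ‖ ^ 2) ^ ((1 : ℝ) / 2) ≤ 1 + 2 * Real.pi * |ξ| := by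
      rw [← Real.sqrt_eq_rpow, Real.sqrt_le_left (by positivity), Real.norm_eq_abs]
      have h1 : |ξ| ≤ 2 * Real.pi * |ξ| := by nlinarith [abs_nonneg ξ, Real.two_le_pi]
      nlinarith [abs_nonneg ξ]
    rw [hξ, norm_mul, norm_mul, Complex.norm_real, Complex.norm_real, hn, Real.norm_of_nonneg
      (by positivity)]
    nlinarith [norm_nonneg ((𝓕 f : L2) ξ)]
  refine ⟨hm.toLp _, ?_⟩
  have hT : (fun ξ : ℝ => (((1 + ‖ξ‖ ^ 2) ^ ((1 : ℝ) / 2) : ℝ) : ℂ)).HasTemperateGrowth := by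
    fun_prop
  ext φ
  rw [TemperedDistribution.smulLeftCLM_apply_apply, Lp.fourier_toTemperedDistribution_eq,
    Lp.toTemperedDistribution_apply, Lp.toTemperedDistribution_apply]
  refine integral_congr_ae ?_
  filter_upwards [hm.coeFn_toLp] with ξ hξ
  rw [hξ, SchwartzMap.smulLeftCLM_apply_apply hT]
  simp only [smul_eq_mul]
  ring

/-- A function of the Hardy space lies in `H¹₊`, with `D f = g`, as soon as `2πξ f̂ = ĝ`. -/
theorem exists_momentum_eq {f g : hardy} (h : ((𝓕 (g : L2) : L2) : ℝ → ℂ) =ᵐ[volume]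
    fun ξ => ((2 * Real.pi * ξ : ℝ) : ℂ) * (𝓕 (f : L2) : L2) ξ) :
    ∃ hf : f ∈ hardySobolev, momentum ⟨f, hf⟩ = g := by
  refine ⟨memSobolev_of_fourier h, Subtype.ext (eq_of_fourier_ae_eq ?_)⟩
  exact (momentum_fourier (momentum_spec _)).trans h.symm

theorem hasDerivAt_schwartz (φ : 𝓢(ℝ, ℂ)) (x : ℝ) : HasDerivAt φ (∂_{(1 : ℝ)} φ x) x := by
  have h1 := φ.differentiableAt (x := x)
  rw [SchwartzMap.lineDerivOp_apply_eq_fderiv]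
  exact h1.hasFDerivAt.hasDerivAt

theorem integrable_schwartz_mul (φ : 𝓢(ℝ, ℂ)) {H : ℝ → ℂ} (hH : MemLp H 2 volume) :
    Integrable (fun x => φ x * H x) volume :=
  (φ.memLp 2 volume).integrable_mul hH

/-- A continuously differentiable function of the Hardy space with square integrable derivative
lies in `H¹₊`, and `D` acts on it as `-i d/dx`. -/
theorem exists_momentum_of_hasDerivAt {f : hardy} {g : L2} {F F' : ℝ → ℂ}
    (hf : ((f : L2) : ℝ → ℂ) =ᵐ[volume] F) (hF : ∀ x, HasDerivAt F (F' x) x)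
    (hg : (g : ℝ → ℂ) =ᵐ[volume] fun x => -Complex.I * F' x) :
    ∃ h : f ∈ hardySobolev, (momentum ⟨f, h⟩ : L2) = g := by
  have hF2 : MemLp F 2 volume := (memLp_congr_ae hf).1 (Lp.memLp _)
  have hF'2 : MemLp F' 2 volume := by
    have h1 : MemLp (fun x => -Complex.I * F' x) 2 volume := (memLp_congr_ae hg).1 (Lp.memLp _)
    refine (memLp_congr_ae (.of_forall fun x => ?_)).1 (h1.const_mul Complex.I)
    linear_combination (-F' x) * Complex.I_mul_I
  have hT : Lp.toTemperedDistribution g =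
      (-Complex.I) • ∂_{(1 : ℝ)} (Lp.toTemperedDistribution (f : L2)) := by
    ext φ
    rw [smul_apply, TemperedDistribution.lineDerivOp_apply_apply, Lp.toTemperedDistribution_apply,
      Lp.toTemperedDistribution_apply]
    have h3 := integral_mul_deriv_eq_deriv_mul_of_integrable
      (fun x _ => hasDerivAt_schwartz φ x) (fun x _ => hF x) (integrable_schwartz_mul φ hF'2)
      (integrable_schwartz_mul _ hF2) (integrable_schwartz_mul φ hF2)
    have h4 : ∫ x, φ x • g x = -Complex.I * ∫ x, φ x * F' x := by
      rw [← integral_const_mul]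
      refine integral_congr_ae ?_
      filter_upwards [hg] with x hx
      rw [hx, smul_eq_mul]
      ring
    have h5 : ∫ x, (-∂_{(1 : ℝ)} φ) x • (f : L2) x = -∫ x, ∂_{(1 : ℝ)} φ x * F x := by
      rw [← integral_neg]
      refine integral_congr_ae ?_
      filter_upwards [hf] with x hx
      rw [hx, smul_eq_mul, neg_apply]
      ring
    rw [h4, h3, h5, smul_eq_mul]
  have h6 := momentum_fourier hT
  have hgh : g ∈ hardy := by
    have h7 : ∀ᵐ ξ : ℝ, ξ < 0 → (𝓕 (f : L2) : L2) ξ = 0 := f.2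
    change ∀ᵐ ξ : ℝ, ξ < 0 → (𝓕 g : L2) ξ = 0
    filter_upwards [h6, h7] with ξ h8 h9 h10
    rw [h8, h9 h10, mul_zero]
  obtain ⟨h, h'⟩ := exists_momentum_eq (f := f) (g := ⟨g, hgh⟩) h6
  exact ⟨h, by rw [h']⟩

theorem symbolMul_coeFn (u : L2) (h : hardySobolev) :
    (symbolMul u h : ℝ → ℂ) =ᵐ[volume] fun x => u x * ((h : hardy) : L2) x :=
  (memLp_mul u h).coeFn_toLp

theorem lax_apply (u : L2) (h : hardySobolev) :
    lax u h = momentum h - szego (symbolMul u h) := rfl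

/-- The operator `D` is symmetric: on the Fourier side it is multiplication by a real function. -/
theorem inner_momentum (f g : hardySobolev) :
    inner ℂ (momentum f : L2) ((g : hardy) : L2) =
      inner ℂ ((f : hardy) : L2) (momentum g : L2) := by
  rw [← Lp.inner_fourier_eq, ← Lp.inner_fourier_eq ((f : hardy) : L2), L2.inner_def, L2.inner_def]
  refine integral_congr_ae ?_
  filter_upwards [momentum_fourier (momentum_spec f), momentum_fourier (momentum_spec g)]
    with ξ h1 h2
  rw [h1, h2, RCLike.inner_apply, RCLike.inner_apply, map_mul, Complex.conj_ofReal]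
  ring

/-- For real `u`, the Lax operator is symmetric. -/
theorem inner_lax {u : L2} (hu : ∀ᵐ x : ℝ, (u x).im = 0) (f g : hardySobolev) :
    inner ℂ (lax u f : L2) ((g : hardy) : L2) = inner ℂ ((f : hardy) : L2) (lax u g : L2) := by
  rw [lax_apply, lax_apply, Submodule.coe_sub, Submodule.coe_sub, inner_sub_left, inner_sub_right,
    inner_momentum, inner_szego, inner_szego_left, L2.inner_def (symbolMul u f),
    L2.inner_def _ (symbolMul u g)]
  congr 1
  refine integral_congr_ae ?_
  filter_upwards [symbolMul_coeFn u f, symbolMul_coeFn u g, hu] with x h1 h2 h3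
  rw [h1, h2, RCLike.inner_apply, RCLike.inner_apply, map_mul, Complex.conj_eq_iff_im.2 h3]
  ring

/-- Eigenvalues of the Lax operator of a real potential are real. -/
theorem eigenvalue_real {u : L2} (hu : ∀ᵐ x : ℝ, (u x).im = 0) {μ : ℂ} {φ : hardySobolev}
    (h : lax u φ = μ • (φ : hardy)) (h0 : φ ≠ 0) : (μ.re : ℂ) = μ := by
  have h1 := inner_lax hu φ φ
  rw [h, Submodule.coe_smul, inner_smul_left, inner_smul_right] at h1
  have h2 : inner ℂ ((φ : hardy) : L2) ((φ : hardy) : L2) ≠ (0 : ℂ) := by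
    rw [Ne, inner_self_eq_zero]
    exact fun h => h0 (Subtype.ext (Subtype.ext h))
  exact Complex.conj_eq_iff_re.1 (mul_right_cancel₀ h2 h1)

/-! ### Rational functions in the Hardy space -/

/-- The function `1 / (x - p)` is, up to a factor, the inverse Fourier transform of a decaying
exponential on the positive half-line. -/
theorem inv_sub_mem_hardy {p : ℂ} (hp : p.im < 0) :
    ∃ f ∈ hardy, (f : ℝ → ℂ) =ᵐ[volume] fun x => ((x : ℂ) - p)⁻¹ := by
  set E : ℝ → ℂ := (Set.Ioi (0 : ℝ)).indicator
    fun ξ => Complex.exp (-(2 * Real.pi * Complex.I * p) * ξ) with hE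
  have hre : (-(2 * Real.pi * Complex.I * p)).re < 0 := by
    have : (-(2 * Real.pi * Complex.I * p)).re = 2 * Real.pi * p.im := by simp
    rw [this]
    exact mul_neg_of_pos_of_neg Real.two_pi_pos hp
  have hbound (a : ℂ) (ha : a.re < 0) :
      IntegrableOn (fun ξ : ℝ => Complex.exp (a * ξ)) (Set.Ioi 0) volume :=
    integrableOn_exp_mul_complex_Ioi ha 0
  have h1 : Integrable E volume := (integrable_indicator_iff measurableSet_Ioi).2 (hbound _ hre)
  have h2 : MemLp E 2 volume := by
    rw [memLp_two_iff_integrable_sq_norm h1.aestronglyMeasurable]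
    have h3 : (fun ξ => ‖E ξ‖ ^ 2) = (Set.Ioi (0 : ℝ)).indicator
        fun ξ => ‖Complex.exp ((2 * -(2 * Real.pi * Complex.I * p)) * ξ)‖ := by
      ext ξ
      by_cases hξ : ξ ∈ Set.Ioi (0 : ℝ)
      · rw [hE, Set.indicator_of_mem hξ, Set.indicator_of_mem hξ, ← norm_pow, ← Complex.exp_nat_mul]
        push_cast
        ring_nf
      · rw [hE, Set.indicator_of_notMem hξ, Set.indicator_of_notMem hξ]
        simp
    rw [h3, integrable_indicator_iff measurableSet_Ioi]
    refine (hbound _ ?_).norm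
    rw [Complex.mul_re]
    norm_num at hre ⊢
    linarith
  have h0 : (2 * Real.pi * Complex.I : ℂ) ≠ 0 := by simp [Real.pi_ne_zero]
  refine ⟨(-(2 * Real.pi * Complex.I)) • (𝓕⁻ (h2.toLp E) : L2), ?_, ?_⟩
  · refine hardy.smul_mem _ ?_
    change ∀ᵐ ξ : ℝ, ξ < 0 → (𝓕 (𝓕⁻ (h2.toLp E) : L2) : L2) ξ = 0
    rw [fourier_fourierInv_eq]
    filter_upwards [h2.coeFn_toLp] with ξ h4 h5
    rw [h4, hE, Set.indicator_of_notMem]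
    simpa using h5.le
  · filter_upwards [fourierInv_toLp h1 h2, Lp.coeFn_smul (-(2 * Real.pi * Complex.I))
      (𝓕⁻ (h2.toLp E) : L2)] with x h4 h5
    rw [h5, Pi.smul_apply, h4, Real.fourierInv_eq']
    have h6 : ∀ ξ : ℝ, Complex.exp (((2 * Real.pi * inner ℝ ξ x : ℝ) : ℂ) * Complex.I) • E ξ =
        (Set.Ioi (0 : ℝ)).indicator
          (fun ξ : ℝ => Complex.exp ((2 * Real.pi * Complex.I * (x - p)) * ξ)) ξ := by
      intro ξ
      by_cases hξ : ξ ∈ Set.Ioi (0 : ℝ)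
      · rw [hE, Set.indicator_of_mem hξ, Set.indicator_of_mem hξ, smul_eq_mul, ← Complex.exp_add]
        congr 1
        simp
        ring
      · rw [hE, Set.indicator_of_notMem hξ, Set.indicator_of_notMem hξ, smul_zero]
    simp_rw [h6]
    have h7 : (2 * Real.pi * Complex.I * (x - p)).re < 0 := by
      have : (2 * Real.pi * Complex.I * (x - p)).re = 2 * Real.pi * p.im := by simp
      rw [this]
      exact mul_neg_of_pos_of_neg Real.two_pi_pos hp
    rw [integral_indicator measurableSet_Ioi, integral_exp_mul_complex_Ioi h7]
    have h8 := ofReal_sub_ne_zero hp.ne x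
    simp only [Complex.ofReal_zero, mul_zero, Complex.exp_zero, smul_eq_mul]
    field_simp

open Polynomial in
/-- A polynomial is stable if it is nonzero and all of its roots lie in the open lower
half-plane. -/
def IsStable (Q : ℂ[X]) : Prop := Q ≠ 0 ∧ ∀ z, Q.eval z = 0 → z.im < 0

section Rational

open Polynomial

theorem IsStable.eval_ne_zero {Q : ℂ[X]} (hQ : IsStable Q) (x : ℝ) : Q.eval (x : ℂ) ≠ 0 :=
  fun h => by simpa using hQ.2 _ h

theorem IsStable.mul {P Q : ℂ[X]} (hP : IsStable P) (hQ : IsStable Q) : IsStable (P * Q) := by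
  refine ⟨mul_ne_zero hP.1 hQ.1, fun z hz => ?_⟩
  rw [eval_mul, mul_eq_zero] at hz
  exact hz.elim (hP.2 z) (hQ.2 z)

/-- A proper rational function all of whose poles lie in the lower half-plane belongs to the Hardy
space. -/
theorem exists_hardy_ratio {Q : ℂ[X]} (hQ : IsStable Q) {A : ℂ[X]} (hA : A.degree < Q.degree) :
    ∃ f ∈ hardy, (f : ℝ → ℂ) =ᵐ[volume] fun x => A.eval (x : ℂ) / Q.eval (x : ℂ) := by
  induction hn : Q.natDegree generalizing Q A with
  | zero =>
    rw [eq_C_of_natDegree_eq_zero hn] at hA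
    have hA0 : A = 0 := by
      rw [← degree_eq_bot]
      have := hA.trans_le degree_C_le
      exact Nat.WithBot.lt_zero_iff.1 this
    refine ⟨0, hardy.zero_mem, ?_⟩
    filter_upwards [Lp.coeFn_zero ℂ 2 (volume : Measure ℝ)] with x hx
    rw [hx, hA0]
    simp
  | succ n ih =>
    obtain ⟨p, hp⟩ := IsAlgClosed.exists_root Q
      (fun h => by
        have := natDegree_eq_zero_iff_degree_le_zero.2 h.le
        omega)
    have hpim : p.im < 0 := hQ.2 p hp
    obtain ⟨Q₁, rfl⟩ := dvd_iff_isRoot.2 hp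
    have hQ₁0 : Q₁ ≠ 0 := right_ne_zero_of_mul hQ.1
    have hQ₁ : IsStable Q₁ := ⟨hQ₁0, fun z hz => hQ.2 z (by rw [eval_mul, hz, mul_zero])⟩
    have hn₁ : Q₁.natDegree = n := by
      rw [natDegree_mul (X_sub_C_ne_zero p) hQ₁0, natDegree_X_sub_C] at hn
      omega
    have hdiv : A = (X - C p) * (A /ₘ (X - C p)) + C (A.eval p) := by
      rw [← modByMonic_X_sub_C_eq_C_eval, add_comm]
      exact (modByMonic_add_div A (X - C p)).symm
    set A₁ := A /ₘ (X - C p) with hA₁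
    have hA₁d : A₁.degree < Q₁.degree := by
      by_cases h0 : A₁ = 0
      · rw [h0, degree_zero]
        exact bot_lt_iff_ne_bot.2 (degree_ne_bot.2 hQ₁0)
      · have h1 : (X - C p).degree ≤ A.degree := by
          by_contra h2
          exact h0 ((divByMonic_eq_zero_iff (monic_X_sub_C p)).2 (not_le.1 h2))
        have h3 := degree_add_divByMonic (monic_X_sub_C p) h1
        rw [← h3, degree_mul, ← hA₁, degree_X_sub_C, degree_eq_natDegree h0,
          degree_eq_natDegree hQ₁0] at hA
        rw [degree_eq_natDegree h0, degree_eq_natDegree hQ₁0]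
        norm_cast at hA ⊢
        omega
    obtain ⟨f₁, hf₁, hf₁e⟩ := ih hQ₁ hA₁d hn₁
    -- `A / ((X - p) Q₁) = A₁ / Q₁ + A(p) / ((X - p) Q₁)`, where `A₁` is the quotient of `A` by
    -- `X - p`
    have key : ∃ f₂ ∈ hardy, (f₂ : ℝ → ℂ) =ᵐ[volume]
        fun x => A.eval p / ((x - p) * Q₁.eval (x : ℂ)) := by
      by_cases hn0 : n = 0
      · obtain ⟨f, hf, hfe⟩ := inv_sub_mem_hardy hpim
        have hQc := eq_C_of_natDegree_eq_zero (hn₁.trans hn0)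
        refine ⟨(A.eval p / Q₁.coeff 0) • f, hardy.smul_mem _ hf, ?_⟩
        filter_upwards [hfe, Lp.coeFn_smul (A.eval p / Q₁.coeff 0) f] with x h1 h2
        rw [h2, Pi.smul_apply, h1, hQc, eval_C, coeff_C_zero, smul_eq_mul]
        field_simp
      · have hd : (C (A.eval p)).degree < Q₁.degree := by
          refine degree_C_le.trans_lt ?_
          rw [degree_eq_natDegree hQ₁0, hn₁]
          exact_mod_cast Nat.pos_of_ne_zero hn0
        obtain ⟨f, hf, hfe⟩ := ih hQ₁ hd hn₁
        have hm := mulBounded_coeFn _ (memLp_top_inv_sub hpim.ne) f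
        refine ⟨_, inv_sub_mul_mem_hardy hf hpim hm, ?_⟩
        filter_upwards [hm, hfe] with x h1 h2
        rw [h1, h2, eval_C]
        field_simp
    obtain ⟨f₂, hf₂, hf₂e⟩ := key
    refine ⟨f₁ + f₂, hardy.add_mem hf₁ hf₂, ?_⟩
    filter_upwards [hf₁e, hf₂e, Lp.coeFn_add f₁ f₂] with x h1 h2 h3
    rw [h3, Pi.add_apply, h1, h2, eval_mul, eval_sub, eval_X, eval_C]
    conv_rhs => rw [hdiv]
    rw [eval_add, eval_mul, eval_sub, eval_X, eval_C, eval_C]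
    have h4 := ofReal_sub_ne_zero hpim.ne x
    have h5 := hQ₁.eval_ne_zero x
    field_simp

/-- The polynomial with conjugate coefficients. -/
def conjPoly (Q : ℂ[X]) : ℂ[X] := Q.map (starRingEnd ℂ)

theorem eval_conjPoly (Q : ℂ[X]) (z : ℂ) :
    (conjPoly Q).eval z = starRingEnd ℂ (Q.eval (starRingEnd ℂ z)) := by
  rw [conjPoly, ← Polynomial.eval_map_apply]
  simp

theorem eval_conjPoly_ofReal (Q : ℂ[X]) (x : ℝ) :
    (conjPoly Q).eval (x : ℂ) = starRingEnd ℂ (Q.eval (x : ℂ)) := by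
  rw [eval_conjPoly, Complex.conj_ofReal]

theorem degree_conjPoly (Q : ℂ[X]) : (conjPoly Q).degree = Q.degree :=
  degree_map Q _

theorem conjPoly_conjPoly (Q : ℂ[X]) : conjPoly (conjPoly Q) = Q := by
  rw [conjPoly, conjPoly, Polynomial.map_map]
  convert Polynomial.map_id
  ext
  simp

theorem IsStable.isCoprime_conjPoly {Q : ℂ[X]} (hQ : IsStable Q) : IsCoprime Q (conjPoly Q) := by
  rw [Polynomial.isCoprime_iff_aeval_ne_zero_of_isAlgClosed (K := ℂ) (k := ℂ)]
  intro z
  by_contra h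
  push Not at h
  simp only [coe_aeval_eq_eval] at h
  have h1 := hQ.2 _ h.1
  have h2 := h.2
  rw [eval_conjPoly, map_eq_zero] at h2
  have h3 := hQ.2 _ h2
  rw [Complex.conj_im] at h3
  linarith

/-- Partial fractions: a proper fraction with denominator a product of two coprime polynomials is
the sum of two proper fractions. -/
theorem exists_partial_fractions {Q R C : ℂ[X]} (h : IsCoprime Q R) (hQ : Q ≠ 0) (hR : R ≠ 0)
    (hC : C.degree < (Q * R).degree) :
    ∃ A B : ℂ[X], A.degree < Q.degree ∧ B.degree < R.degree ∧ C = A * R + B * Q := by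
  obtain ⟨a, b, hab⟩ := h
  have h1 : C * b = (C * b) % Q + Q * ((C * b) / Q) := (EuclideanDomain.mod_add_div _ _).symm
  have hA : ((C * b) % Q).degree < Q.degree := degree_mod_lt _ hQ
  have h2 : C = ((C * b) % Q) * R + (C * a + (C * b) / Q * R) * Q := by
    linear_combination (-C) * hab + R * h1
  refine ⟨_, _, hA, ?_, h2⟩
  have h3 : ((C * a + (C * b) / Q * R) * Q).degree < (Q * R).degree := by
    have h4 : (C * a + (C * b) / Q * R) * Q = C - ((C * b) % Q) * R := by
      linear_combination -h2
    rw [h4]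
    refine (degree_sub_le _ _).trans_lt (max_lt hC ?_)
    rw [degree_mul, degree_mul]
    exact WithBot.add_lt_add_right (degree_ne_bot.2 hR) hA
  rw [degree_mul, degree_mul, add_comm Q.degree] at h3
  exact lt_of_add_lt_add_right h3

/-- The Szegő projection of a proper rational function whose poles are off the real axis keeps the
poles in the lower half-plane. -/
theorem szego_ratio {Q C : ℂ[X]} (hQ : IsStable Q) (hC : C.degree < (Q * conjPoly Q).degree)
    {f : L2} (hf : (f : ℝ → ℂ) =ᵐ[volume]
      fun x => C.eval (x : ℂ) / (Q * conjPoly Q).eval (x : ℂ)) :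
    ∃ A : ℂ[X], A.degree < Q.degree ∧
      ((szego f : L2) : ℝ → ℂ) =ᵐ[volume] fun x => A.eval (x : ℂ) / Q.eval (x : ℂ) := by
  have hR0 : conjPoly Q ≠ 0 := by
    rw [← degree_ne_bot, degree_conjPoly, degree_ne_bot]
    exact hQ.1
  obtain ⟨A, B, hA, hB, h⟩ := exists_partial_fractions hQ.isCoprime_conjPoly hQ.1 hR0 hC
  obtain ⟨a, ha, hae⟩ := exists_hardy_ratio hQ hA
  obtain ⟨b, hb, hbe⟩ := exists_hardy_ratio hQ (A := conjPoly B)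
    (by rwa [degree_conjPoly, ← degree_conjPoly Q])
  have h1 : f = a + star b := by
    apply Lp.ext
    filter_upwards [hf, hae, hbe, Lp.coeFn_add a (star b), Lp.coeFn_star b] with x h2 h3 h4 h5 h6
    rw [h2, h5, Pi.add_apply, h6, Pi.star_apply, h3, h4, h, eval_mul, eval_add, eval_mul, eval_mul,
      Complex.star_def, map_div₀, ← eval_conjPoly_ofReal, ← eval_conjPoly_ofReal,
      conjPoly_conjPoly]
    have h7 := hQ.eval_ne_zero x
    have h8 : (conjPoly Q).eval (x : ℂ) ≠ 0 := by
      rw [eval_conjPoly_ofReal, Ne, map_eq_zero]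
      exact h7
    field_simp
  refine ⟨A, hA, ?_⟩
  rw [h1, map_add, szego_coe ⟨a, ha⟩, szego_star ⟨b, hb⟩, add_zero]
  exact hae

end Rational

/-! ### The generator of the adjoint shift semigroup as multiplication by `x` -/

/-- A function with a simple pole singularity on the real line is not square integrable. -/
theorem eq_zero_of_integrableOn_div_sub {G : ℝ → ℂ} {a : ℝ} (hG : ContinuousAt G a)
    (h : IntegrableOn (fun x => ‖G x / ((x : ℂ) - a)‖ ^ 2) (Set.Ioc a (a + 1)) volume) :
    G a = 0 := by
  by_contra h0
  refine not_intervalIntegrable_of_sub_inv_isBigO_punctured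
    (f := fun x => ‖G x / ((x : ℂ) - a)‖ ^ 2) (a := a) (b := a + 1) (c := a) ?_ (by simp)
    (by simp) ((intervalIntegrable_iff_integrableOn_Ioc_of_le (by simp)).2 h)
  have hn : 0 < ‖G a‖ := norm_pos_iff.2 h0
  have h1 : ∀ᶠ x in 𝓝 a, ‖G a‖ / 2 < ‖G x‖ :=
    hG.norm.eventually_const_lt (by linarith)
  have h2 : ∀ᶠ x in 𝓝 a, |x - a| < 1 := by
    filter_upwards [Metric.ball_mem_nhds a one_pos] with x hx
    simpa [Real.dist_eq] using hx
  refine Asymptotics.IsBigO.of_bound (4 / ‖G a‖ ^ 2) ?_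
  filter_upwards [nhdsWithin_le_nhds h1, nhdsWithin_le_nhds h2, self_mem_nhdsWithin]
    with x h3 h4 h5
  have h6 : 0 < |x - a| := abs_pos.2 (sub_ne_zero.2 h5)
  have h7 : ‖(x : ℂ) - a‖ = |x - a| := by
    rw [← Complex.ofReal_sub, Complex.norm_real, Real.norm_eq_abs]
  rw [norm_inv, Real.norm_eq_abs, Real.norm_of_nonneg (sq_nonneg _), norm_div, h7,
    div_pow, div_mul_div_comm, inv_eq_one_div, div_le_div_iff₀ h6 (by positivity), one_mul]
  have h8 : ‖G a‖ ^ 2 ≤ 4 * ‖G x‖ ^ 2 := by nlinarith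
  have h9 : |x - a| ^ 2 ≤ |x - a| := by nlinarith
  calc ‖G a‖ ^ 2 * |x - a| ^ 2 ≤ (4 * ‖G x‖ ^ 2) * |x - a| := by gcongr
    _ = _ := by ring

/-- The relation `x f = g + const`. On the Hardy space it describes the graph of `G`. -/
def MulRel (f g : L2) : Prop := ∃ c : ℂ, ∀ᵐ x : ℝ, (x : ℂ) * f x = g x + c

/-- The symbol of the difference quotient of the shift semigroup, divided by `x`. -/
def quotientSymbol (η x : ℝ) : ℂ := (Complex.exp (-(Complex.I * η * x)) - 1) / (η * x)

theorem measurable_quotientSymbol (η : ℝ) : Measurable (quotientSymbol η) := by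
  unfold quotientSymbol
  fun_prop

theorem norm_quotientSymbol_le (η x : ℝ) : ‖quotientSymbol η x‖ ≤ 1 := by
  have h := Real.norm_exp_I_mul_ofReal_sub_one_le (x := -(η * x))
  rw [show Complex.I * ((-(η * x) : ℝ) : ℂ) = -(Complex.I * η * x) by push_cast; ring,
    norm_neg] at h
  rw [quotientSymbol, norm_div, ← Complex.ofReal_mul, Complex.norm_real]
  exact div_le_one_of_le₀ h (norm_nonneg _)

theorem memLp_top_quotientSymbol (η : ℝ) : MemLp (quotientSymbol η) ∞ (volume : Measure ℝ) :=
  memLp_top_of_bound (measurable_quotientSymbol η).aestronglyMeasurable 1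
    (.of_forall (norm_quotientSymbol_le η))

theorem tendsto_quotientSymbol {x : ℝ} (hx : x ≠ 0) :
    Tendsto (fun η => quotientSymbol η x) (𝓝[>] 0) (𝓝 (-Complex.I)) := by
  have h1 : HasDerivAt (fun η : ℝ => Complex.exp (-(Complex.I * η * x)))
      (Complex.exp (-(Complex.I * (0 : ℝ) * x)) * (-(Complex.I * 1 * x))) 0 := by
    have h2 : HasDerivAt (fun η : ℝ => (η : ℂ)) 1 0 := Complex.ofRealCLM.hasDerivAt
    exact (((h2.const_mul Complex.I).mul_const (x : ℂ)).neg).cexp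
  have h3 := (h1.tendsto_slope_zero).mono_left (nhdsWithin_mono 0 (fun y hy => ne_of_gt hy))
  have hx' : (x : ℂ) ≠ 0 := by exact_mod_cast hx
  have h4 := h3.mul_const (x : ℂ)⁻¹
  rw [show (Complex.exp (-(Complex.I * (0 : ℝ) * x)) * (-(Complex.I * 1 * x))) * (x : ℂ)⁻¹ =
    -Complex.I by simp [hx']] at h4
  refine h4.congr' ?_
  filter_upwards [self_mem_nhdsWithin] with η hη
  have : (η : ℂ) ≠ 0 := by exact_mod_cast ne_of_gt hη
  rw [quotientSymbol, zero_add, Complex.real_smul]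
  simp only [Complex.ofReal_zero, mul_zero, zero_mul, neg_zero, Complex.exp_zero]
  push_cast
  field_simp

/-- The quotient symbol is a superposition of the exponentials `e^{-isx}` with `0 ≤ s ≤ η`, hence
is annihilated by `Π`. -/
theorem exists_szego_quotientSymbol {η : ℝ} (hη : 0 < η) :
    ∃ K : L2, (K : ℝ → ℂ) =ᵐ[volume] quotientSymbol η ∧ szego K = 0 := by
  set a := η / (2 * Real.pi) with ha
  have ha0 : 0 < a := by positivity
  set E : ℝ → ℂ := (Set.Ioc (-a) 0).indicator fun _ => 1 with hE
  have h1 : Integrable E volume :=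
    (integrable_indicator_iff measurableSet_Ioc).2 (integrableOn_const (by simp))
  have h2 : MemLp E 2 volume := memLp_indicator_const 2 measurableSet_Ioc 1 (Or.inr (by simp))
  have hπ : (Real.pi : ℂ) ≠ 0 := by exact_mod_cast Real.pi_ne_zero
  have hη' : (η : ℂ) ≠ 0 := by exact_mod_cast hη.ne'
  set c : ℂ := -(2 * Real.pi * Complex.I) / η with hc
  refine ⟨c • (𝓕⁻ (h2.toLp E) : L2), ?_, ?_⟩
  · filter_upwards [fourierInv_toLp h1 h2, Lp.coeFn_smul c (𝓕⁻ (h2.toLp E) : L2),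
      compl_mem_ae_iff.2 (measure_singleton (0 : ℝ))] with x h3 h4 h5
    have hx : (x : ℂ) ≠ 0 := by exact_mod_cast h5
    rw [h4, Pi.smul_apply, h3, Real.fourierInv_eq']
    have h6 : ∀ ξ : ℝ, Complex.exp (((2 * Real.pi * inner ℝ ξ x : ℝ) : ℂ) * Complex.I) • E ξ =
        (Set.Ioc (-a) 0).indicator
          (fun ξ : ℝ => Complex.exp ((2 * Real.pi * Complex.I * x) * ξ)) ξ := by
      intro ξ
      by_cases hξ : ξ ∈ Set.Ioc (-a) 0
      · rw [hE, Set.indicator_of_mem hξ, Set.indicator_of_mem hξ, smul_eq_mul, mul_one]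
        congr 1
        simp
        ring
      · rw [hE, Set.indicator_of_notMem hξ, Set.indicator_of_notMem hξ, smul_zero]
    simp_rw [h6]
    rw [integral_indicator measurableSet_Ioc, ← intervalIntegral.integral_of_le (by linarith),
      integral_exp_mul_complex
        (mul_ne_zero (by simp [Real.pi_ne_zero]) hx : 2 * Real.pi * Complex.I * (x : ℂ) ≠ 0)]
    have h7 : 2 * Real.pi * Complex.I * x * ((-a : ℝ) : ℂ) = -(Complex.I * η * x) := by
      rw [ha]
      push_cast
      field_simp
    rw [h7, quotientSymbol, hc, smul_eq_mul]
    simp only [Complex.ofReal_zero, mul_zero, Complex.exp_zero]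
    field_simp
    ring
  · rw [map_smul]
    have h3 : szego (𝓕⁻ (h2.toLp E) : L2) = 0 := by
      refine szego_eq_zero ?_
      rw [fourier_fourierInv_eq]
      filter_upwards [h2.coeFn_toLp] with ξ h4 h5
      rw [h4, hE, Set.indicator_of_notMem]
      simp [h5]
    rw [h3, smul_zero]

theorem norm_sq_eq_integral (h : L2) : ‖h‖ ^ 2 = ∫ x, ‖h x‖ ^ 2 := by
  have h1 := inner_self_eq_norm_sq_to_K (𝕜 := ℂ) h
  rw [L2.inner_def] at h1
  simp only [inner_self_eq_norm_sq_to_K] at h1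
  have h2 : ∫ x, ((‖h x‖ : ℂ)) ^ 2 = ((∫ x, ‖h x‖ ^ 2 : ℝ) : ℂ) := by
    rw [← integral_complex_ofReal]
    simp
  have h3 := h2.symm.trans h1
  exact (Complex.ofReal_injective (h3.trans (by simp))).symm

/-- A pair of functions of the Hardy space with `x f = g + const` belongs to the graph of `G`. -/
theorem MulRel.hasShiftDeriv {f g : hardy} (h : MulRel f g) :
    HasShiftDeriv f (-Complex.I • g) := by
  obtain ⟨c, hc⟩ := h
  have h1 : ∀ η : ℝ, 0 < η → ((η⁻¹ : ℝ) : ℂ) • (shiftAdjoint η f - f) =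
      szego (mulBounded _ (memLp_top_quotientSymbol η) g) := by
    intro η hη
    obtain ⟨K, hK, hK0⟩ := exists_szego_quotientSymbol hη
    have hη' : (η : ℂ) ≠ 0 := by exact_mod_cast hη.ne'
    have h2 : ((η⁻¹ : ℝ) : ℂ) • (mulBounded _ (memLp_exp η) (f : L2) - (f : L2)) =
        mulBounded _ (memLp_top_quotientSymbol η) g + c • K := by
      apply Lp.ext
      filter_upwards [hc, hK, mulBounded_coeFn _ (memLp_exp η) (f : L2),
        mulBounded_coeFn _ (memLp_top_quotientSymbol η) (g : L2), Lp.coeFn_smul c K,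
        Lp.coeFn_add (mulBounded _ (memLp_top_quotientSymbol η) (g : L2)) (c • K),
        Lp.coeFn_sub (mulBounded _ (memLp_exp η) (f : L2)) (f : L2),
        Lp.coeFn_smul ((η⁻¹ : ℝ) : ℂ) (mulBounded _ (memLp_exp η) (f : L2) - (f : L2)),
        compl_mem_ae_iff.2 (measure_singleton (0 : ℝ))] with x a1 a2 a3 a4 a5 a6 a7 a8 a9
      have hx : (x : ℂ) ≠ 0 := by exact_mod_cast a9
      rw [a8, a6, Pi.smul_apply, a7, Pi.add_apply, Pi.sub_apply, a5, Pi.smul_apply, a4, a3, a2,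
        smul_eq_mul, smul_eq_mul, quotientSymbol]
      have a10 : (g : L2) x = x * (f : L2) x - c := by rw [a1]; ring
      rw [a10]
      push_cast
      field_simp
      ring
    have h3 : shiftAdjoint η f - f = szego (mulBounded _ (memLp_exp η) (f : L2) - (f : L2)) := by
      rw [map_sub, szego_coe]
      rfl
    rw [h3, ← map_smul, h2, map_add, map_smul, hK0, smul_zero, add_zero]
  have h4 : Tendsto (fun η => mulBounded _ (memLp_top_quotientSymbol η) (g : L2)) (𝓝[>] 0)
      (𝓝 (-Complex.I • (g : L2))) := by
    rw [tendsto_iff_norm_sub_tendsto_zero]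
    have h5 : Tendsto (fun η => ‖mulBounded _ (memLp_top_quotientSymbol η) (g : L2) -
        -Complex.I • (g : L2)‖ ^ 2) (𝓝[>] 0) (𝓝 0) := by
      have h6 : ∀ η, ‖mulBounded _ (memLp_top_quotientSymbol η) (g : L2) -
          -Complex.I • (g : L2)‖ ^ 2 =
          ∫ x, ‖(quotientSymbol η x - -Complex.I) * (g : L2) x‖ ^ 2 := by
        intro η
        rw [norm_sq_eq_integral]
        refine integral_congr_ae ?_
        filter_upwards [mulBounded_coeFn _ (memLp_top_quotientSymbol η) (g : L2),
          Lp.coeFn_sub (mulBounded _ (memLp_top_quotientSymbol η) (g : L2))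
            (-Complex.I • (g : L2)), Lp.coeFn_smul (-Complex.I) (g : L2)] with x a1 a2 a3
        rw [a2, Pi.sub_apply, a1, a3, Pi.smul_apply, smul_eq_mul, sub_mul]
      simp_rw [h6]
      rw [show (0 : ℝ) = ∫ _ : ℝ, (0 : ℝ) by simp]
      refine tendsto_integral_filter_of_dominated_convergence
        (fun x => 4 * ‖(g : L2) x‖ ^ 2) (.of_forall fun η => ?_) (.of_forall fun η => ?_) ?_ ?_
      · exact ((((measurable_quotientSymbol η).sub_const _).aestronglyMeasurable.mul
          (Lp.aestronglyMeasurable _)).norm.pow 2)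
      · refine .of_forall fun x => ?_
        have a1 : ‖quotientSymbol η x - -Complex.I‖ ≤ 2 := by
          refine (norm_sub_le _ _).trans ?_
          rw [norm_neg, Complex.norm_I]
          linarith [norm_quotientSymbol_le η x]
        rw [Real.norm_of_nonneg (by positivity), norm_mul, mul_pow]
        gcongr
        nlinarith [norm_nonneg (quotientSymbol η x - -Complex.I)]
      · exact ((memLp_two_iff_integrable_sq_norm (Lp.aestronglyMeasurable _)).1
          (Lp.memLp (g : L2))).const_mul 4
      · filter_upwards [compl_mem_ae_iff.2 (measure_singleton (0 : ℝ))] with x hx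
        have a1 := (((tendsto_quotientSymbol hx).sub_const (-Complex.I)).mul_const
          ((g : L2) x)).norm.pow 2
        simpa using a1
    have h7 := h5.sqrt
    simpa using h7
  have h8 := (szego.continuous.tendsto _).comp h4
  rw [map_smul, szego_coe] at h8
  refine h8.congr' ?_
  filter_upwards [self_mem_nhdsWithin] with η hη
  exact (h1 η hη).symm

theorem MulRel.generator_eq {f g : hardy} (h : MulRel f g) :
    ∃ hf : f ∈ generator.domain, generator ⟨f, hf⟩ = g := by
  have h1 := h.hasShiftDeriv
  refine ⟨⟨_, h1⟩, ?_⟩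
  have h2 : ∀ hf : f ∈ generatorDomain, hf.choose = -Complex.I • g :=
    fun hf => tendsto_nhds_unique hf.choose_spec h1
  change Complex.I • Exists.choose _ = g
  rw [h2 ⟨_, h1⟩, smul_smul]
  simp

/-! ### Finite-dimensional subspaces invariant under `G` -/

section Invariant

open Polynomial

variable {V : Submodule ℂ hardy} {M : V →ₗ[ℂ] V}

/-- Iterating the relation `x f = M f + const`, powers of `x` act as powers of `M` up to
polynomials. -/
theorem exists_pow_mul_eq (hM : ∀ f : V, MulRel (f : hardy) (M f : hardy)) (f : V) (k : ℕ) :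
    ∃ R : ℂ[X], R ∈ degreeLT ℂ k ∧ ∀ᵐ x : ℝ, (x : ℂ) ^ k * ((f : hardy) : L2) x =
      (((M ^ k) f : V) : L2) x + R.eval (x : ℂ) := by
  induction k with
  | zero => exact ⟨0, Submodule.zero_mem _, .of_forall fun x => by simp⟩
  | succ k ih =>
    obtain ⟨R, hR, h⟩ := ih
    obtain ⟨c, hc⟩ := hM ((M ^ k) f)
    refine ⟨X * R + C c, ?_, ?_⟩
    · rw [mem_degreeLT] at hR ⊢
      refine (degree_add_le _ _).trans_lt (max_lt ?_ ?_)
      · by_cases hR0 : R = 0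
        · simp [hR0]
        · rw [degree_mul, degree_X, degree_eq_natDegree hR0] at *
          norm_cast at *
          omega
      · exact degree_C_le.trans_lt (by norm_cast; omega)
    · filter_upwards [h, hc] with x h1 h2
      rw [pow_succ' M, Module.End.mul_apply, pow_succ', mul_assoc, h1, mul_add, h2, eval_add,
        eval_mul, eval_X, eval_C]
      ring

theorem coe_sum_smul (n : ℕ) (a : ℕ → ℂ) (h : ℕ → L2) :
    ∀ᵐ x : ℝ, (∑ i ∈ Finset.range n, a i • h i : L2) x = ∑ i ∈ Finset.range n, a i * h i x := by
  induction n with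
  | zero =>
    filter_upwards [Lp.coeFn_zero ℂ 2 (volume : Measure ℝ)] with x _
    simp
  | succ n ih =>
    rw [Finset.sum_range_succ]
    filter_upwards [ih, Lp.coeFn_add (∑ i ∈ Finset.range n, a i • h i) (a n • h n),
      Lp.coeFn_smul (a n) (h n)] with x h1 h2 h3
    rw [h2, Pi.add_apply, h1, h3, Finset.sum_range_succ, Pi.smul_apply, smul_eq_mul]

theorem exists_poly_mul_eq (hM : ∀ f : V, MulRel (f : hardy) (M f : hardy)) (f : V) (P : ℂ[X]) :
    ∃ R : ℂ[X], R ∈ degreeLT ℂ P.natDegree ∧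
      ∀ᵐ x : ℝ, P.eval (x : ℂ) * ((f : hardy) : L2) x =
        ((aeval M P f : V) : L2) x + R.eval (x : ℂ) := by
  choose R hR h using exists_pow_mul_eq hM f
  refine ⟨∑ i ∈ Finset.range (P.natDegree + 1), P.coeff i • R i,
    Submodule.sum_mem _ fun i hi => Submodule.smul_mem _ _ ?_, ?_⟩
  · exact degreeLT_mono (by have := Finset.mem_range.1 hi; omega) (hR i)
  · have h1 : (((aeval M P f : V) : hardy) : L2) = ∑ i ∈ Finset.range (P.natDegree + 1),
        P.coeff i • ((((M ^ i) f : V) : hardy) : L2) := by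
      rw [aeval_eq_sum_range, LinearMap.sum_apply]
      simp
    rw [h1]
    filter_upwards [coe_sum_smul (P.natDegree + 1) P.coeff
      fun i => ((((M ^ i) f : V) : hardy) : L2), ae_all_iff.2 h] with x h2 h3
    rw [h2, eval_finsetSum, eval_eq_sum_range, Finset.sum_mul, ← Finset.sum_add_distrib]
    refine Finset.sum_congr rfl fun i _ => ?_
    rw [eval_smul, smul_eq_mul, mul_assoc, h3]
    ring

variable [FiniteDimensional ℂ V]

/-- By the Cayley–Hamilton theorem, the elements of a finite-dimensional subspace which is
invariant under `G` are fractions with denominator the characteristic polynomial of `G`. -/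
theorem exists_charpoly_mul_eq (hM : ∀ f : V, MulRel (f : hardy) (M f : hardy)) (f : V) :
    ∃ R : ℂ[X], R ∈ degreeLT ℂ (Module.finrank ℂ V) ∧
      ∀ᵐ x : ℝ, M.charpoly.eval (x : ℂ) * ((f : hardy) : L2) x = R.eval (x : ℂ) := by
  obtain ⟨R, hR, h⟩ := exists_poly_mul_eq hM f M.charpoly
  rw [LinearMap.charpoly_natDegree] at hR
  refine ⟨R, hR, ?_⟩
  filter_upwards [h] with x h1
  rw [h1, LinearMap.aeval_self_charpoly]
  simp

/-- The eigenvalues of `G` on an invariant subspace lie in the lower half-plane: an eigenvector is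
a multiple of `1 / (x - p)`, and this function belongs to the Hardy space for no other `p`. -/
theorem isStable_charpoly (hM : ∀ f : V, MulRel (f : hardy) (M f : hardy)) :
    IsStable M.charpoly := by
  refine ⟨(LinearMap.charpoly_monic M).ne_zero, fun p hp => ?_⟩
  obtain ⟨f, hf⟩ := ((Module.End.hasEigenvalue_iff_isRoot_charpoly M p).2 hp).exists_hasEigenvector
  have hMf := hf.apply_eq_smul
  obtain ⟨c, hc⟩ := hM f
  rw [hMf] at hc
  have h1 : ∀ᵐ x : ℝ, ((x : ℂ) - p) * ((f : hardy) : L2) x = c := by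
    filter_upwards [hc, Lp.coeFn_smul p ((f : hardy) : L2)] with x h2 h3
    rw [Submodule.coe_smul, Submodule.coe_smul, h3, Pi.smul_apply, smul_eq_mul] at h2
    linear_combination h2
  by_contra hpim
  apply hf.2
  apply Subtype.ext
  apply Subtype.ext
  rcases (not_lt.1 hpim).eq_or_lt with h0 | h0
  · have hp' : p = (p.re : ℂ) := Complex.ext rfl (by simp [h0])
    have hp0 : ∀ᵐ x : ℝ, (x : ℂ) - p ≠ 0 := by
      filter_upwards [compl_mem_ae_iff.2 (measure_singleton p.re)] with x hx
      rw [hp', sub_ne_zero]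
      exact_mod_cast hx
    have hc0 : c = 0 := by
      refine eq_zero_of_integrableOn_div_sub (G := fun _ => c) (a := p.re) continuousAt_const ?_
      have h2 := (memLp_two_iff_integrable_sq_norm (Lp.aestronglyMeasurable _)).1
        (Lp.memLp ((f : hardy) : L2))
      refine (h2.congr ?_).integrableOn
      filter_upwards [h1, hp0] with x h3 h4
      rw [← hp', ← h3, mul_div_cancel_left₀ _ h4]
    apply Lp.ext
    filter_upwards [h1, hp0, Lp.coeFn_zero ℂ 2 (volume : Measure ℝ)] with x h3 h4 h5
    rw [hc0, mul_eq_zero, or_iff_right h4] at h3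
    rw [h3]
    exact h5.symm
  · obtain ⟨k, hk, hke⟩ := inv_sub_mem_hardy (p := starRingEnd ℂ p) (by simpa using h0)
    have h2 : ((f : hardy) : L2) = c • star k := by
      apply Lp.ext
      filter_upwards [h1, hke, Lp.coeFn_smul c (star k), Lp.coeFn_star k] with x h3 h4 h5 h6
      rw [h5, Pi.smul_apply, h6, Pi.star_apply, h4, ← h3]
      have h7 := ofReal_sub_ne_zero h0.ne' x
      simp only [Complex.star_def, map_inv₀, map_sub, Complex.conj_ofReal, Complex.conj_conj,
        smul_eq_mul]
      field_simp
    have h3 : szego ((f : hardy) : L2) = 0 := by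
      rw [h2, map_smul, szego_star ⟨k, hk⟩, smul_zero]
    rw [szego_coe] at h3
    rw [h3]
    rfl

end Invariant

/-! ### Eigenfunctions of the Lax operator on the Fourier side -/

/-- Integration by parts on the Fourier side: if `f̂` has a differentiable representative `Φ` on
`(0, ∞)` and `ĝ = (i / 2π) Φ'`, then `x f = g + (i / 2π) Φ(0)`; the constant is the contribution
of the jump of `f̂` at the origin. -/
theorem mulRel_of_hasDerivAt {f g : hardy} {Φ Φ' : ℝ → ℂ} (hΦ : ∀ ξ, 0 < ξ → HasDerivAt Φ (Φ' ξ) ξ)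
    (hΦ0 : ContinuousWithinAt Φ (Set.Ioi 0) 0) (hΦi : Tendsto Φ atTop (𝓝 0))
    (hf : ∀ᵐ ξ : ℝ, 0 < ξ → (𝓕 (f : L2) : L2) ξ = Φ ξ)
    (hg : ∀ᵐ ξ : ℝ, 0 < ξ → (𝓕 (g : L2) : L2) ξ = Complex.I / (2 * Real.pi) * Φ' ξ) :
    ∀ᵐ x : ℝ, (x : ℂ) * (f : L2) x = (g : L2) x + Complex.I / (2 * Real.pi) * Φ 0 := by
  have hπ : (Real.pi : ℂ) ≠ 0 := by exact_mod_cast Real.pi_ne_zero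
  have hcx : Continuous fun x : ℝ => (x : ℂ) := Complex.continuous_ofReal
  refine ae_eq_of_schwartz ((locallyIntegrable_L2 _).continuous_mul hcx)
    ((locallyIntegrable_L2 _).add (locallyIntegrable_const _)) fun φ _ => ?_
  set ρ : 𝓢(ℝ, ℂ) := 𝓕⁻ φ with hρ
  have hρφ : 𝓕 ρ = φ := fourier_fourierInv_eq φ
  have hρφ' : 𝓕 (ρ : ℝ → ℂ) = φ := by rw [← SchwartzMap.fourier_coe, hρφ]
  have hρ' : ∀ x, 𝓕 ((∂_{(1 : ℝ)} ρ : 𝓢(ℝ, ℂ)) : ℝ → ℂ) x = 2 * Real.pi * Complex.I * x * φ x := by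
    intro x
    have hT : (fun x : ℝ => inner ℝ x (1 : ℝ)).HasTemperateGrowth := by fun_prop
    rw [← SchwartzMap.fourier_coe, SchwartzMap.fourier_lineDerivOp_eq, hρφ, smul_apply,
      SchwartzMap.smulLeftCLM_apply_apply hT]
    simp
    ring
  have hneg (k : hardy) : ∀ᵐ ξ : ℝ, ξ < 0 → (𝓕 (k : L2) : L2) ξ = 0 := k.2
  have hcut (k : hardy) (ψ : 𝓢(ℝ, ℂ)) {H : ℝ → ℂ}
      (hH : ∀ᵐ ξ : ℝ, 0 < ξ → (𝓕 (k : L2) : L2) ξ = H ξ) :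
      ∫ ξ, ψ ξ * (𝓕 (k : L2) : L2) ξ = ∫ ξ in Set.Ioi 0, ψ ξ * H ξ := by
    rw [← integral_indicator measurableSet_Ioi]
    refine integral_congr_ae ?_
    filter_upwards [hH, hneg k, ae_lt_or_gt] with ξ h1 h2 h3
    rcases h3 with h3 | h3
    · rw [h2 h3, Set.indicator_of_notMem (by simpa using h3.le), mul_zero]
    · rw [h1 h3, Set.indicator_of_mem (by simpa using h3)]
  have hint (k : hardy) (ψ : 𝓢(ℝ, ℂ)) {H : ℝ → ℂ}
      (hH : ∀ᵐ ξ : ℝ, 0 < ξ → (𝓕 (k : L2) : L2) ξ = H ξ) :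
      IntegrableOn (fun ξ => ψ ξ * H ξ) (Set.Ioi 0) volume := by
    refine ((integrable_schwartz_mul ψ (Lp.memLp (𝓕 (k : L2) : L2))).integrableOn
      (s := Set.Ioi 0)).congr ?_
    filter_upwards [ae_restrict_of_ae hH, ae_restrict_mem measurableSet_Ioi] with ξ h1 h2
    rw [h1 h2]
  have hg' : ∀ᵐ ξ : ℝ, 0 < ξ →
      (𝓕 ((-(2 * Real.pi * Complex.I) • g : hardy) : L2) : L2) ξ = Φ' ξ := by
    rw [Submodule.coe_smul, FourierSMul.fourier_smul]
    filter_upwards [hg, Lp.coeFn_smul (-(2 * Real.pi * Complex.I)) (𝓕 (g : L2) : L2)]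
      with ξ h1 h2 h3
    rw [h2, Pi.smul_apply, h1 h3, smul_eq_mul]
    field_simp
    linear_combination (-Φ' ξ) * Complex.I_sq
  have hparts := integral_Ioi_mul_deriv_eq_deriv_mul (a := 0) (u := ρ) (v := Φ)
    (u' := (∂_{(1 : ℝ)} ρ : 𝓢(ℝ, ℂ))) (v' := Φ') (a' := ρ 0 * Φ 0) (b' := 0 * 0)
    (fun ξ _ => hasDerivAt_schwartz ρ ξ) hΦ (hint _ ρ hg') (hint f (∂_{(1 : ℝ)} ρ) hf)
    (((ρ.continuous.tendsto 0).mono_left nhdsWithin_le_nhds).mul hΦ0)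
    ((ρ.tendsto_cocompact.mono_left atTop_le_cocompact).mul hΦi)
  have hρ0 : ρ 0 = ∫ x, φ x := by
    rw [hρ, SchwartzMap.fourierInv_coe, Real.fourierInv_eq']
    simp
  -- the left-hand side is the pairing of `f̂` with the derivative of `ρ`
  have e1 : ∫ x, φ x • ((x : ℂ) * (f : L2) x) =
      (2 * Real.pi * Complex.I)⁻¹ * ∫ ξ in Set.Ioi 0, ∂_{(1 : ℝ)} ρ ξ * Φ ξ := by
    rw [← hcut f _ hf, integral_schwartz_mul_fourier, ← integral_const_mul]
    refine integral_congr_ae (.of_forall fun x => ?_)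
    simp only [hρ', smul_eq_mul]
    have := Complex.I_ne_zero
    field_simp
  have e2 : ∫ x, φ x * (g : L2) x =
      ∫ ξ in Set.Ioi 0, ρ ξ * (Complex.I / (2 * Real.pi) * Φ' ξ) := by
    rw [← hcut g _ hg, integral_schwartz_mul_fourier, hρφ']
  have e3 : ∫ x, φ x • ((g : L2) x + Complex.I / (2 * Real.pi) * Φ 0) =
      (∫ x, φ x * (g : L2) x) + (∫ x, φ x) * (Complex.I / (2 * Real.pi) * Φ 0) := by
    rw [← integral_mul_const, ← integral_add (integrable_schwartz_mul φ (Lp.memLp _))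
      (φ.integrable.mul_const _)]
    refine integral_congr_ae (.of_forall fun x => ?_)
    simp only [smul_eq_mul]
    ring
  have e4 : ∫ ξ in Set.Ioi 0, ρ ξ * (Complex.I / (2 * Real.pi) * Φ' ξ) =
      Complex.I / (2 * Real.pi) * ∫ ξ in Set.Ioi 0, ρ ξ * Φ' ξ := by
    rw [← integral_const_mul]
    refine integral_congr_ae (.of_forall fun x => ?_)
    ring
  rw [e1, e3, e2, e4, ← hρ0, hparts]
  have hI := Complex.I_ne_zero
  field_simp
  rw [Complex.I_sq]
  ring

/-- If `u` and `x u` are square integrable, then the product of `u` with an element of `H¹₊` has a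
differentiable Fourier transform, whose derivative is a multiple of the transform of `y = x u φ`. -/
theorem exists_fourier_symbolMul {u : L2} (hxu : MemLp (fun x : ℝ => (x : ℂ) * u x) 2 volume)
    (φ : hardySobolev) : ∃ (W W' : ℝ → ℂ) (y : L2),
      (∀ ξ, HasDerivAt W (W' ξ) ξ) ∧ Tendsto W atTop (𝓝 0) ∧
      ((𝓕 (symbolMul u φ) : L2) : ℝ → ℂ) =ᵐ[volume] W ∧
      W 0 = ∫ x, u x * ((φ : hardy) : L2) x ∧
      (y : ℝ → ℂ) =ᵐ[volume] (fun x => x * (u x * ((φ : hardy) : L2) x)) ∧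
      (∀ᵐ ξ : ℝ, W' ξ = -(2 * Real.pi * Complex.I) * (𝓕 y : L2) ξ) := by
  set v : ℝ → ℂ := fun x => u x * ((φ : hardy) : L2) x with hv
  have h1 : Integrable v volume := (Lp.memLp u).integrable_mul (Lp.memLp _)
  have h2 : Integrable (fun x : ℝ => x * v x) volume := by
    refine (hxu.integrable_mul (Lp.memLp ((φ : hardy) : L2))).congr (.of_forall fun x => ?_)
    change (x : ℂ) * u x * ((φ : hardy) : L2) x = x * (u x * ((φ : hardy) : L2) x)
    ring
  have h3 : MemLp (fun x : ℝ => x * v x) 2 volume := by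
    refine (memLp_congr_ae (.of_forall fun x => ?_)).1 ((hardySobolev_memLp_top φ).mul hxu)
    change (x : ℂ) * u x * ((φ : hardy) : L2) x = x * (u x * ((φ : hardy) : L2) x)
    ring
  have h4 : Integrable (fun x : ℝ => x • v x) volume :=
    h2.congr (.of_forall fun x => by simp)
  refine ⟨𝓕 v, _, h3.toLp _, fun ξ => Real.hasDerivAt_fourier h1 h4 ξ,
    (Real.zero_at_infty_fourier v).mono_left atTop_le_cocompact,
    fourier_toLp h1 (memLp_mul u φ), ?_, h3.coeFn_toLp, ?_⟩
  · rw [Real.fourier_eq']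
    simp
  · filter_upwards [fourier_toLp h2 h3] with ξ h5
    rw [h5, Real.fourier_eq', Real.fourier_eq', ← integral_const_mul]
    refine integral_congr_ae (.of_forall fun x => ?_)
    simp only [smul_eq_mul]
    ring

theorem fourier_eigenfunction {u : L2} {φ : hardySobolev} {l : ℝ}
    (h : lax u φ = (l : ℂ) • (φ : hardy)) : ∀ᵐ ξ : ℝ, 0 < ξ →
      ((2 * Real.pi * ξ - l : ℝ) : ℂ) * (𝓕 ((φ : hardy) : L2) : L2) ξ =
        (𝓕 (symbolMul u φ) : L2) ξ := by
  have h1 : (momentum φ : L2) = (szego (symbolMul u φ) : L2) + (l : ℂ) • ((φ : hardy) : L2) := by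
    rw [lax_apply, sub_eq_iff_eq_add'] at h
    rw [h]
    rfl
  have h2 : (𝓕 (momentum φ : L2) : L2) =
      𝓕 (szego (symbolMul u φ) : L2) + (l : ℂ) • 𝓕 ((φ : hardy) : L2) := by
    rw [h1, FourierAdd.fourier_add, FourierSMul.fourier_smul]
  filter_upwards [momentum_fourier (momentum_spec φ), szego_fourier_of_pos (symbolMul u φ),
    Lp.coeFn_add (𝓕 (szego (symbolMul u φ) : L2) : L2) ((l : ℂ) • 𝓕 ((φ : hardy) : L2)),
    Lp.coeFn_smul (l : ℂ) (𝓕 ((φ : hardy) : L2) : L2)] with ξ h3 h4 h5 h6 h7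
  rw [h2, h5, Pi.add_apply, h4 h7, h6, Pi.smul_apply, smul_eq_mul] at h3
  push_cast at h3 ⊢
  linear_combination (-1 : ℂ) * h3

theorem integrableOn_norm_sq (f : L2) (s : Set ℝ) :
    IntegrableOn (fun x => ‖f x‖ ^ 2) s volume :=
  ((memLp_two_iff_integrable_sq_norm (Lp.aestronglyMeasurable _)).1 (Lp.memLp f)).integrableOn

/-- An eigenfunction `φ` of the Lax operator with eigenvalue `l` satisfies
`-2πl ‖φ‖² = |∫ u φ|²`, and nonnegative eigenvalues do not occur. In the form stated here this
follows by integrating the derivative of `|W|² / (2πξ - l)` over `(0, ∞)`, where `W` is the Fourier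
transform of `u φ`: since `u` is real, the term `Re ∫ W' conj φ̂` vanishes. -/
theorem eigenfunction_eq_zero {u : L2} (hu : ∀ᵐ x : ℝ, (u x).im = 0)
    (hxu : MemLp (fun x : ℝ => (x : ℂ) * u x) 2 volume) {φ : hardySobolev} {l : ℝ}
    (h : lax u φ = (l : ℂ) • (φ : hardy))
    (hl : 0 ≤ l ∨ ∫ x, u x * ((φ : hardy) : L2) x = 0) : φ = 0 := by
  obtain ⟨W, W', y, hW, hWi, hWe, hW0, hy, hWy⟩ := exists_fourier_symbolMul hxu φ
  set f : L2 := 𝓕 ((φ : hardy) : L2) with hf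
  have hfneg : ∀ᵐ ξ : ℝ, ξ < 0 → f ξ = 0 := (φ : hardy).2
  have hfW : ∀ᵐ ξ : ℝ, 0 < ξ → ((2 * Real.pi * ξ - l : ℝ) : ℂ) * f ξ = W ξ := by
    filter_upwards [fourier_eigenfunction h, hWe] with ξ h1 h2 h3
    rw [h1 h3, h2]
  set a : ℝ := l / (2 * Real.pi) with ha
  have hla : ∀ ξ, 2 * Real.pi * ξ - l = 2 * Real.pi * (ξ - a) := by
    intro ξ
    rw [ha]
    have := Real.pi_ne_zero
    field_simp
  simp_rw [hla] at hfW
  have hπ := Real.two_pi_pos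
  set ρ : ℝ → ℝ := fun ξ => ‖W ξ‖ ^ 2 / (2 * Real.pi * (ξ - a)) with hρ
  set r : ℝ → ℝ := fun ξ => (2 * inner ℝ (W ξ) (W' ξ) * (2 * Real.pi * (ξ - a)) -
    ‖W ξ‖ ^ 2 * (2 * Real.pi)) / (2 * Real.pi * (ξ - a)) ^ 2 with hr
  have hρr : ∀ ξ, ξ ≠ a → HasDerivAt ρ (r ξ) ξ := by
    intro ξ hξ
    have h1 : HasDerivAt (fun ξ => 2 * Real.pi * (ξ - a)) (2 * Real.pi) ξ := by
      simpa using ((hasDerivAt_id ξ).sub_const a).const_mul (2 * Real.pi)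
    exact (hW ξ).norm_sq.div h1 (mul_ne_zero hπ.ne' (sub_ne_zero.2 hξ))
  have hρi : Tendsto ρ atTop (𝓝 0) := by
    have h1 : Tendsto (fun ξ : ℝ => 2 * Real.pi * (ξ - a)) atTop atTop :=
      (tendsto_atTop_add_const_right _ (-a) tendsto_id).const_mul_atTop hπ
    have h2 := (hWi.norm.pow 2).div_atTop h1
    exact h2
  -- the derivative of `ρ`, expressed through `φ̂`
  set s : ℝ → ℝ := fun ξ => 2 * (inner ℂ (f ξ) (-(2 * Real.pi * Complex.I) * (𝓕 y : L2) ξ)).re -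
    2 * Real.pi * ‖f ξ‖ ^ 2 with hs
  have hrs : ∀ᵐ ξ : ℝ, 0 < ξ → r ξ = s ξ := by
    filter_upwards [hfW, hWy, compl_mem_ae_iff.2 (measure_singleton a)] with ξ h1 h2 h3 h4
    have h5 : ξ - a ≠ 0 := sub_ne_zero.2 h3
    have h6 := h1 h4
    simp only [hr, hs]
    rw [← h2, ← h6, norm_mul, Complex.norm_real, mul_pow, Real.norm_eq_abs, sq_abs, Complex.inner,
      RCLike.inner_apply, map_mul, Complex.conj_ofReal, mul_left_comm (W' ξ),
      Complex.re_ofReal_mul]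
    field_simp
  have hcross : Integrable
      (fun ξ => inner ℂ (f ξ) (-(2 * Real.pi * Complex.I) * (𝓕 y : L2) ξ)) volume := by
    refine ((L2.integrable_inner f (𝓕 y : L2)).const_mul (-(2 * Real.pi * Complex.I))).congr
      (.of_forall fun ξ => ?_)
    simp only [RCLike.inner_apply]
    ring
  have hsi : Integrable s volume :=
    (hcross.re.const_mul 2).sub
      (((memLp_two_iff_integrable_sq_norm (Lp.aestronglyMeasurable _)).1 (Lp.memLp f)).const_mul _)
  have hcross0 : (∫ ξ, inner ℂ (f ξ) (-(2 * Real.pi * Complex.I) * (𝓕 y : L2) ξ)).re = 0 := by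
    have h1 : ∫ ξ, inner ℂ (f ξ) (-(2 * Real.pi * Complex.I) * (𝓕 y : L2) ξ) =
        -(2 * Real.pi * Complex.I) * inner ℂ ((φ : hardy) : L2) y := by
      rw [← Lp.inner_fourier_eq, L2.inner_def, ← integral_const_mul]
      refine integral_congr_ae (.of_forall fun ξ => ?_)
      simp only [RCLike.inner_apply]
      ring
    have h2 : inner ℂ ((φ : hardy) : L2) y =
        ((∫ x, x * (u x).re * ‖((φ : hardy) : L2) x‖ ^ 2 : ℝ) : ℂ) := by
      rw [L2.inner_def, ← integral_complex_ofReal]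
      refine integral_congr_ae ?_
      filter_upwards [hy, hu] with x h3 h4
      rw [h3, RCLike.inner_apply]
      have h5 : u x = ((u x).re : ℂ) := Complex.ext rfl (by simp [h4])
      conv_lhs => rw [h5]
      rw [mul_assoc, mul_assoc, Complex.mul_conj]
      push_cast
      rw [← Complex.ofReal_pow, Complex.normSq_eq_norm_sq]
      ring
    rw [h1, h2]
    simp
  have hsint : ∫ ξ, s ξ = -(2 * Real.pi * ‖φ.1‖ ^ 2) := by
    have hs' : ∫ ξ, s ξ =
        (∫ ξ, 2 * (inner ℂ (f ξ) (-(2 * Real.pi * Complex.I) * (𝓕 y : L2) ξ)).re) -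
          ∫ ξ, 2 * Real.pi * ‖f ξ‖ ^ 2 := integral_sub (hcross.re.const_mul 2)
      (((memLp_two_iff_integrable_sq_norm (Lp.aestronglyMeasurable _)).1
        (Lp.memLp f)).const_mul _)
    have h1 : ∫ ξ, (inner ℂ (f ξ) (-(2 * Real.pi * Complex.I) * (𝓕 y : L2) ξ)).re = 0 := by
      rw [← hcross0]
      exact integral_re hcross
    have h2 : ‖φ.1‖ = ‖f‖ := by
      rw [hf, Lp.norm_fourier_eq]
      rfl
    rw [hs', integral_const_mul, integral_const_mul, h1, h2, norm_sq_eq_integral]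
    ring
  have hsr : ∫ ξ in Set.Ioi 0, r ξ = ∫ ξ, s ξ := by
    rw [← integral_indicator measurableSet_Ioi]
    refine integral_congr_ae ?_
    filter_upwards [hrs, hfneg, ae_lt_or_gt] with ξ h1 h2 h3
    rcases h3 with h3 | h3
    · rw [Set.indicator_of_notMem (by simpa using h3.le)]
      simp [hs, h2 h3]
    · rw [Set.indicator_of_mem (by simpa using h3), h1 h3]
  have hri : IntegrableOn r (Set.Ioi 0) volume := by
    refine (hsi.integrableOn (s := Set.Ioi 0)).congr ?_
    filter_upwards [ae_restrict_of_ae hrs, ae_restrict_mem measurableSet_Ioi] with ξ h1 h2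
    exact (h1 h2).symm
  have hnonneg : 0 ≤ ∫ ξ in Set.Ioi 0, r ξ := by
    rcases lt_or_ge a 0 with ha0 | ha0
    · have hl0 : l < 0 := by
        by_contra h1
        have : 0 ≤ a := div_nonneg (not_lt.1 h1) hπ.le
        linarith
      have h0 : W 0 = 0 := by rw [hW0, hl.resolve_left (not_le.2 hl0)]
      have h1 := integral_Ioi_of_hasDerivAt_of_tendsto
        (hρr 0 ha0.ne').continuousAt.continuousWithinAt
        (fun ξ (hξ : 0 < ξ) => hρr ξ (by linarith : a < ξ).ne') hri hρi
      rw [h1]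
      simp [hρ, h0]
    · -- `W` vanishes at `a`, because `W / (ξ - a)` is square integrable near `a`
      have hWa : W a = 0 := by
        refine eq_zero_of_integrableOn_div_sub (hW a).continuousAt ?_
        refine ((integrableOn_norm_sq f (Set.Ioc a (a + 1))).const_mul ((2 * Real.pi) ^ 2)).congr ?_
        filter_upwards [ae_restrict_of_ae hfW, ae_restrict_mem measurableSet_Ioc] with ξ h1 h2
        have h3 : ξ - a ≠ 0 := sub_ne_zero.2 h2.1.ne'
        have h4 : (ξ : ℂ) - a ≠ 0 := by exact_mod_cast h3
        rw [← h1 (ha0.trans_lt h2.1)]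
        push_cast
        rw [show 2 * Real.pi * ((ξ : ℂ) - a) * f ξ / (ξ - a) = ((2 * Real.pi : ℝ) : ℂ) * f ξ by
          push_cast
          field_simp, norm_mul, Complex.norm_real, Real.norm_of_nonneg hπ.le]
        ring
      have hρa : ρ a = 0 := by simp [hρ]
      have hcont : ContinuousAt ρ a := by
        rw [continuousAt_iff_punctured_nhds, hρa]
        have h1 := (hW a).tendsto_slope.norm
        have h2 : Tendsto (fun ξ => ‖W ξ‖) (𝓝[≠] a) (𝓝 0) := by
          have := (hW a).continuousAt.norm.tendsto.mono_left (nhdsWithin_le_nhds (s := {a}ᶜ))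
          simpa [hWa] using this
        have h3 := (h1.mul h2).mul_const (2 * Real.pi)⁻¹
        rw [mul_zero, zero_mul] at h3
        refine squeeze_zero_norm (fun ξ => ?_) h3
        rw [slope_def_module, hWa, sub_zero, norm_smul, hρ, norm_div, norm_mul, norm_pow, norm_norm,
          norm_inv, Real.norm_of_nonneg hπ.le, div_eq_mul_inv, mul_inv]
        apply le_of_eq
        ring
      have hri' : IntegrableOn r (Set.Ioi a) volume := hri.mono_set (Set.Ioi_subset_Ioi ha0)
      have hri'' : IntegrableOn r (Set.Ioc 0 a) volume := hri.mono_set Set.Ioc_subset_Ioi_self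
      have h1 := integral_Ioi_of_hasDerivAt_of_tendsto hcont.continuousWithinAt
        (fun ξ (hξ : a < ξ) => hρr ξ hξ.ne') hri' hρi
      have h2 : ContinuousOn ρ (Set.Icc 0 a) := by
        intro ξ hξ
        rcases eq_or_ne ξ a with rfl | h3
        · exact hcont.continuousWithinAt
        · exact (hρr ξ h3).continuousAt.continuousWithinAt
      have h3 := intervalIntegral.integral_eq_sub_of_hasDerivAt_of_le ha0 h2
        (fun ξ hξ => hρr ξ hξ.2.ne)
        ((intervalIntegrable_iff_integrableOn_Ioc_of_le ha0).2 hri'')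
      rw [intervalIntegral.integral_of_le ha0] at h3
      rw [← Set.Ioc_union_Ioi_eq_Ioi ha0, setIntegral_union
        Set.Ioc_disjoint_Ioi_same measurableSet_Ioi hri'' hri',
        h1, h3, hρa]
      have h4 : ρ 0 ≤ 0 := div_nonpos_of_nonneg_of_nonpos (by positivity)
        (mul_nonpos_of_nonneg_of_nonpos hπ.le (by linarith))
      linarith
  rw [hsr, hsint] at hnonneg
  have h1 : ‖φ.1‖ ^ 2 = 0 := by nlinarith [sq_nonneg ‖φ.1‖]
  exact Subtype.ext (norm_eq_zero.1 (pow_eq_zero_iff two_ne_zero |>.1 h1))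

/-- An eigenfunction `φ` with negative eigenvalue `l` is in the domain of `G`, and `g = G φ`
satisfies the commutator identity `(L - l) g = -i φ + c Π u`. -/
theorem exists_mulRel_eigenfunction {u : L2}
    (hxu : MemLp (fun x : ℝ => (x : ℂ) * u x) 2 volume) {φ : hardySobolev} {l : ℝ}
    (h : lax u φ = (l : ℂ) • (φ : hardy)) (hl : l < 0) :
    ∃ (g : hardySobolev) (c : ℂ), MulRel (φ : hardy) (g : hardy) ∧
      lax u g = (l : ℂ) • (g : hardy) - Complex.I • (φ : hardy) + c • szego u := by
  obtain ⟨W, W', y, hW, hWi, hWe, hW0, hy, hWy⟩ := exists_fourier_symbolMul hxu φ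
  have hπ := Real.two_pi_pos
  have hπ' : (Real.pi : ℂ) ≠ 0 := by exact_mod_cast Real.pi_ne_zero
  have hpos : ∀ ξ : ℝ, 0 ≤ ξ → 0 < 2 * Real.pi * ξ - l := fun ξ hξ => by
    have := mul_nonneg hπ.le hξ
    linarith
  set m : ℝ → ℂ := (Set.Ioi (0 : ℝ)).indicator fun ξ => (((2 * Real.pi * ξ - l)⁻¹ : ℝ) : ℂ) with hm
  have hmm : MemLp m ∞ (volume : Measure ℝ) := by
    refine memLp_top_of_bound ((Complex.measurable_ofReal.comp
      (by fun_prop)).indicator measurableSet_Ioi).aestronglyMeasurable (-l)⁻¹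
        (.of_forall fun ξ => ?_)
    by_cases hξ : ξ ∈ Set.Ioi (0 : ℝ)
    · have h1 := mul_pos hπ hξ
      rw [hm, Set.indicator_of_mem hξ, Complex.norm_real,
        Real.norm_of_nonneg (inv_nonneg.2 (hpos ξ (le_of_lt hξ)).le)]
      exact inv_anti₀ (by linarith) (by linarith)
    · rw [hm, Set.indicator_of_notMem hξ, norm_zero]
      exact inv_nonneg.2 (by linarith)
  -- `g` is the solution of `(D - l) g = r`, with `r = Π (x u φ) - i φ`; it is obtained on the
  -- Fourier side through division by `2πξ - l`, which is bounded below because `l < 0`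
  set r : hardy := szego y - Complex.I • (φ : hardy) with hr
  have hgF : 𝓕 (𝓕⁻ (mulBounded m hmm (𝓕 (r : L2))) : L2) = mulBounded m hmm (𝓕 (r : L2)) :=
    fourier_fourierInv_eq _
  have hgm : (𝓕⁻ (mulBounded m hmm (𝓕 (r : L2))) : L2) ∈ hardy := by
    change ∀ᵐ ξ : ℝ, ξ < 0 → (𝓕 (𝓕⁻ (mulBounded m hmm (𝓕 (r : L2))) : L2) : L2) ξ = 0
    rw [hgF]
    filter_upwards [mulBounded_coeFn m hmm (𝓕 (r : L2))] with ξ h1 h2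
    rw [h1, hm, Set.indicator_of_notMem (by simpa using h2.le), zero_mul]
  set g : hardy := ⟨_, hgm⟩ with hg
  have hgr : ∀ᵐ ξ : ℝ, 0 < ξ →
      ((2 * Real.pi * ξ - l : ℝ) : ℂ) * (𝓕 (g : L2) : L2) ξ = (𝓕 (r : L2) : L2) ξ := by
    filter_upwards [mulBounded_coeFn m hmm (𝓕 (r : L2))] with ξ h1 h2
    have h3 : ((2 * Real.pi * ξ - l : ℝ) : ℂ) ≠ 0 := by
      exact_mod_cast (hpos ξ h2.le).ne'
    simp only [hg]
    rw [hgF, h1, hm, Set.indicator_of_mem (by simpa using h2), Complex.ofReal_inv, ← mul_assoc,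
      mul_inv_cancel₀ h3, one_mul]
  have hneg (k : hardy) : ∀ᵐ ξ : ℝ, ξ < 0 → (𝓕 (k : L2) : L2) ξ = 0 := k.2
  obtain ⟨hgS, hgD⟩ := exists_momentum_eq (f := g) (g := (l : ℂ) • g + r) (by
    rw [Submodule.coe_add, Submodule.coe_smul, FourierAdd.fourier_add, FourierSMul.fourier_smul]
    filter_upwards [hgr, hneg g, hneg r, ae_lt_or_gt,
      Lp.coeFn_add ((l : ℂ) • 𝓕 (g : L2) : L2) (𝓕 (r : L2) : L2),
      Lp.coeFn_smul (l : ℂ) (𝓕 (g : L2) : L2)] with ξ h1 h2 h3 h4 h5 h6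
    rw [h5, Pi.add_apply, h6, Pi.smul_apply, smul_eq_mul]
    rcases h4 with h4 | h4
    · rw [h2 h4, h3 h4]
      ring
    · rw [← h1 h4]
      push_cast
      ring)
  have hrF : ∀ᵐ ξ : ℝ, 0 < ξ → (𝓕 (r : L2) : L2) ξ =
      (𝓕 y : L2) ξ - Complex.I * (𝓕 ((φ : hardy) : L2) : L2) ξ := by
    have h1 : (𝓕 (r : L2) : L2) =
        𝓕 (szego y : L2) + (-Complex.I) • 𝓕 ((φ : hardy) : L2) := by
      rw [← FourierSMul.fourier_smul, ← FourierAdd.fourier_add, neg_smul, ← sub_eq_add_neg]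
      rfl
    rw [h1]
    filter_upwards [szego_fourier_of_pos y,
      Lp.coeFn_add (𝓕 (szego y : L2) : L2) ((-Complex.I) • 𝓕 ((φ : hardy) : L2)),
      Lp.coeFn_smul (-Complex.I) (𝓕 ((φ : hardy) : L2) : L2)] with ξ h2 h3 h4 h5
    rw [h3, Pi.add_apply, h2 h5, h4, Pi.smul_apply, smul_eq_mul]
    ring
  -- `φ̂` is the restriction to `(0, ∞)` of `Φ = W / (2πξ - l)`
  set d : ℝ → ℂ := fun ξ => ((2 * Real.pi * ξ - l : ℝ) : ℂ) with hd
  have hd0 : ∀ ξ, 0 ≤ ξ → d ξ ≠ 0 := fun ξ hξ =>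
    Complex.ofReal_ne_zero.2 (hpos ξ hξ).ne'
  have hdd : ∀ ξ, HasDerivAt d (2 * Real.pi : ℝ) ξ := by
    intro ξ
    have h1 : HasDerivAt (fun ξ : ℝ => 2 * Real.pi * ξ - l) (2 * Real.pi) ξ := by
      simpa using ((hasDerivAt_id ξ).const_mul (2 * Real.pi)).sub_const l
    exact h1.ofReal_comp
  have hfW : ∀ᵐ ξ : ℝ, 0 < ξ → (𝓕 ((φ : hardy) : L2) : L2) ξ = W ξ / d ξ := by
    filter_upwards [fourier_eigenfunction h, hWe] with ξ h1 h2 h3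
    rw [← h2, ← h1 h3, mul_div_cancel_left₀ _ (hd0 ξ h3.le)]
  have hΦ : ∀ ξ, 0 ≤ ξ → HasDerivAt (fun ξ => W ξ / d ξ)
      ((W' ξ * d ξ - W ξ * (2 * Real.pi : ℝ)) / d ξ ^ 2) ξ :=
    fun ξ hξ => (hW ξ).div (hdd ξ) (hd0 ξ hξ)
  have hrel := mulRel_of_hasDerivAt (f := φ) (g := g) (fun ξ hξ => hΦ ξ hξ.le)
    (hΦ 0 le_rfl).continuousAt.continuousWithinAt
    (by
      have h1 : Tendsto (fun ξ : ℝ => ‖d ξ‖) atTop atTop := by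
        have h2 : Tendsto (fun ξ : ℝ => 2 * Real.pi * ξ - l) atTop atTop :=
          tendsto_atTop_add_const_right _ (-l) (tendsto_id.const_mul_atTop hπ)
        refine h2.congr' ?_
        filter_upwards [eventually_ge_atTop 0] with ξ hξ
        rw [hd, Complex.norm_real, Real.norm_of_nonneg (hpos ξ hξ).le]
      rw [tendsto_zero_iff_norm_tendsto_zero]
      simp_rw [norm_div]
      exact hWi.norm.div_atTop h1)
    hfW (by
      filter_upwards [hgr, hrF, hfW, hWy] with ξ h1 h2 h3 h4 h5
      have h6 : d ξ * (𝓕 (g : L2) : L2) ξ = _ := h1 h5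
      rw [h2 h5, h3 h5] at h6
      have h7 := hd0 ξ h5.le
      rw [h4]
      have h8 : (𝓕 (g : L2) : L2) ξ = ((𝓕 y : L2) ξ - Complex.I * (W ξ / d ξ)) / d ξ := by
        rw [← h6, mul_div_cancel_left₀ _ h7]
      rw [h8]
      push_cast
      field_simp
      linear_combination (d ξ * (𝓕 y : L2) ξ) * Complex.I_sq)
  set c : ℂ := Complex.I / (2 * Real.pi) * (W 0 / d 0)
  refine ⟨⟨g, hgS⟩, c, ⟨c, hrel⟩, ?_⟩
  have hmul : symbolMul u ⟨g, hgS⟩ = y - c • u := by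
    apply Lp.ext
    filter_upwards [symbolMul_coeFn u ⟨g, hgS⟩, hy, hrel, Lp.coeFn_sub y (c • u),
      Lp.coeFn_smul c u] with x h1 h2 h3 h4 h5
    rw [h1, h4, Pi.sub_apply, h5, Pi.smul_apply, h2, smul_eq_mul]
    have h6 : (g : L2) x = x * ((φ : hardy) : L2) x - c := by rw [h3]; ring
    change u x * (g : L2) x = _
    rw [h6]
    ring
  rw [lax_apply, hgD, hmul, map_sub, map_smul, hr]
  abel

/-! ### Spaces of rational functions with a given denominator -/

section RatioSpace

open Polynomial

theorem polynomial_eq_of_ae_eq {A B : ℂ[X]}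
    (h : ∀ᵐ x : ℝ, A.eval (x : ℂ) = B.eval (x : ℂ)) : A = B := by
  refine eq_of_infinite_eval_eq A B fun hfin => ?_
  have h1 : {x : ℝ | A.eval (x : ℂ) = B.eval (x : ℂ)}.Finite :=
    hfin.preimage Complex.ofReal_injective.injOn
  have h2 : volume {x : ℝ | A.eval (x : ℂ) = B.eval (x : ℂ)} = 0 := h1.measure_zero _
  have h3 : volume (Set.univ : Set ℝ) = 0 := by
    rw [← Set.union_compl_self {x : ℝ | A.eval (x : ℂ) = B.eval (x : ℂ)}]
    exact measure_union_null h2 h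
  simp at h3

theorem degree_lt_of_mem {Q A : ℂ[X]} (hQ : Q ≠ 0) (hA : A ∈ degreeLT ℂ Q.natDegree) :
    A.degree < Q.degree := by
  rwa [degree_eq_natDegree hQ, ← mem_degreeLT]

theorem mem_of_degree_lt {Q A : ℂ[X]} (hA : A.degree < Q.degree) :
    A ∈ degreeLT ℂ Q.natDegree :=
  mem_degreeLT.2 (hA.trans_le degree_le_natDegree)

/-- The functions of the Hardy space of the form `A / Q` with `deg A < deg Q`. -/
def ratioSpace (Q : ℂ[X]) : Submodule ℂ hardy where
  carrier := {f | ∃ A ∈ degreeLT ℂ Q.natDegree,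
    ((f : L2) : ℝ → ℂ) =ᵐ[volume] fun x => A.eval (x : ℂ) / Q.eval (x : ℂ)}
  zero_mem' := by
    refine ⟨0, Submodule.zero_mem _, ?_⟩
    filter_upwards [Lp.coeFn_zero ℂ 2 (volume : Measure ℝ)] with x hx
    rw [ZeroMemClass.coe_zero, hx]
    simp
  add_mem' := by
    rintro f g ⟨A, hA, hf⟩ ⟨B, hB, hg⟩
    refine ⟨A + B, Submodule.add_mem _ hA hB, ?_⟩
    filter_upwards [hf, hg, Lp.coeFn_add (f : L2) (g : L2)] with x h1 h2 h3
    rw [Submodule.coe_add, h3, Pi.add_apply, h1, h2, eval_add, add_div]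
  smul_mem' := by
    rintro a f ⟨A, hA, hf⟩
    refine ⟨a • A, Submodule.smul_mem _ _ hA, ?_⟩
    filter_upwards [hf, Lp.coeFn_smul a (f : L2)] with x h1 h2
    rw [Submodule.coe_smul, h2, Pi.smul_apply, h1, eval_smul, smul_div_assoc]

theorem exists_mem_ratioSpace {Q : ℂ[X]} (hQ : IsStable Q) {A : ℂ[X]}
    (hA : A ∈ degreeLT ℂ Q.natDegree) : ∃ f ∈ ratioSpace Q,
      ((f : L2) : ℝ → ℂ) =ᵐ[volume] fun x => A.eval (x : ℂ) / Q.eval (x : ℂ) := by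
  obtain ⟨f, hf, hfe⟩ := exists_hardy_ratio hQ (degree_lt_of_mem hQ.1 hA)
  exact ⟨⟨f, hf⟩, ⟨A, hA, hfe⟩, hfe⟩

/-- A numerator of an element of `ratioSpace Q`; it is unique. -/
def numerator {Q : ℂ[X]} (f : ratioSpace Q) : ℂ[X] := f.2.choose

theorem numerator_mem {Q : ℂ[X]} (f : ratioSpace Q) : numerator f ∈ degreeLT ℂ Q.natDegree :=
  f.2.choose_spec.1

theorem numerator_spec {Q : ℂ[X]} (f : ratioSpace Q) : (((f : hardy) : L2) : ℝ → ℂ) =ᵐ[volume]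
    fun x => (numerator f).eval (x : ℂ) / Q.eval (x : ℂ) :=
  f.2.choose_spec.2

theorem numerator_eq {Q : ℂ[X]} (hQ : IsStable Q) {f : ratioSpace Q} {A : ℂ[X]}
    (h : (((f : hardy) : L2) : ℝ → ℂ) =ᵐ[volume] fun x => A.eval (x : ℂ) / Q.eval (x : ℂ)) :
    numerator f = A := by
  apply polynomial_eq_of_ae_eq
  filter_upwards [numerator_spec f, h] with x h1 h2
  rw [h1] at h2
  have h3 := hQ.eval_ne_zero x
  field_simp at h2
  exact h2

/-- The space of proper fractions with denominator `Q` is isomorphic to the space of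
numerators. -/
def ratioEquiv {Q : ℂ[X]} (hQ : IsStable Q) : ratioSpace Q ≃ₗ[ℂ] degreeLT ℂ Q.natDegree :=
  LinearEquiv.ofBijective
    { toFun := fun f => ⟨numerator f, numerator_mem f⟩
      map_add' := fun f g => Subtype.ext (numerator_eq hQ (by
        filter_upwards [numerator_spec f, numerator_spec g,
          Lp.coeFn_add ((f : hardy) : L2) ((g : hardy) : L2)] with x h1 h2 h3
        simp only [Submodule.coe_add]
        rw [h3, Pi.add_apply, h1, h2, eval_add, add_div]))
      map_smul' := fun a f => Subtype.ext (numerator_eq hQ (by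
        filter_upwards [numerator_spec f, Lp.coeFn_smul a ((f : hardy) : L2)] with x h1 h2
        simp only [Submodule.coe_smul, RingHom.id_apply]
        rw [h2, Pi.smul_apply, h1, eval_smul, smul_div_assoc])) }
    (by
      constructor
      · intro f g h
        have h0 : numerator f = numerator g := congrArg Subtype.val h
        apply Subtype.ext
        apply Subtype.ext
        apply Lp.ext
        filter_upwards [numerator_spec f, numerator_spec g] with x h1 h2
        rw [h1, h2, h0]
      · rintro ⟨A, hA⟩
        obtain ⟨f, hf, hfe⟩ := exists_mem_ratioSpace hQ hA
        exact ⟨⟨f, hf⟩, Subtype.ext (numerator_eq hQ hfe)⟩)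

theorem finrank_ratioSpace {Q : ℂ[X]} (hQ : IsStable Q) :
    Module.finrank ℂ (ratioSpace Q) = Q.natDegree := by
  rw [((ratioEquiv hQ).trans (degreeLTEquiv ℂ _)).finrank_eq, Module.finrank_fin_fun]

theorem finiteDimensional_ratioSpace {Q : ℂ[X]} (hQ : IsStable Q) :
    FiniteDimensional ℂ (ratioSpace Q) :=
  ((ratioEquiv hQ).trans (degreeLTEquiv ℂ _)).symm.finiteDimensional

theorem hasDerivAt_eval_ofReal (A : ℂ[X]) (x : ℝ) :
    HasDerivAt (fun x : ℝ => A.eval (x : ℂ)) (A.derivative.eval (x : ℂ)) x :=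
  (A.hasDerivAt (x : ℂ)).comp_ofReal

theorem degree_mul_lt_sq {Q A B : ℂ[X]} (hQ : Q ≠ 0) (hA : A.degree < Q.degree)
    (hB : B.degree ≤ Q.degree) : (A * B).degree < (Q * Q).degree := by
  by_cases hB0 : B = 0
  · rw [hB0, mul_zero, degree_zero]
    exact bot_lt_iff_ne_bot.2 (degree_ne_bot.2 (mul_ne_zero hQ hQ))
  · rw [degree_mul, degree_mul]
    exact WithBot.add_lt_add_of_lt_of_le (degree_ne_bot.2 hB0) hA hB

/-- The elements of `ratioSpace Q` lie in the domain of the Lax operator, which acts on them as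
`h ↦ Π (-i h' - u h)`. -/
theorem exists_lax_ratio {Q : ℂ[X]} (hQ : IsStable Q) (u : L2) {f : hardy} {A : ℂ[X]}
    (hA : A ∈ degreeLT ℂ Q.natDegree)
    (hf : ((f : L2) : ℝ → ℂ) =ᵐ[volume] fun x => A.eval (x : ℂ) / Q.eval (x : ℂ)) :
    ∃ (h : f ∈ hardySobolev) (d : L2), lax u (⟨f, h⟩ : hardySobolev) = szego d ∧
      ∀ᵐ x : ℝ, d x = -Complex.I * ((A.derivative.eval (x : ℂ) * Q.eval (x : ℂ) -
        A.eval (x : ℂ) * Q.derivative.eval (x : ℂ)) / Q.eval (x : ℂ) ^ 2) -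
        u x * (A.eval (x : ℂ) / Q.eval (x : ℂ)) := by
  have hA' := degree_lt_of_mem hQ.1 hA
  have hdeg : (-Complex.I • (A.derivative * Q - A * Q.derivative)).degree < (Q * Q).degree := by
    refine (degree_smul_le _ _).trans_lt ((degree_sub_le _ _).trans_lt (max_lt ?_ ?_))
    · exact degree_mul_lt_sq hQ.1 ((degree_derivative_le).trans_lt hA') le_rfl
    · exact degree_mul_lt_sq hQ.1 hA' degree_derivative_le
  obtain ⟨g, hg, hge⟩ := exists_hardy_ratio (hQ.mul hQ) hdeg
  have hge' : (g : ℝ → ℂ) =ᵐ[volume] fun x => -Complex.I * ((A.derivative.eval (x : ℂ) *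
      Q.eval (x : ℂ) - A.eval (x : ℂ) * Q.derivative.eval (x : ℂ)) / Q.eval (x : ℂ) ^ 2) := by
    filter_upwards [hge] with x h1
    rw [h1, eval_smul, eval_sub, eval_mul, eval_mul, eval_mul, smul_eq_mul]
    ring
  obtain ⟨h, hm⟩ := exists_momentum_of_hasDerivAt hf
    (fun x => (hasDerivAt_eval_ofReal A x).div (hasDerivAt_eval_ofReal Q x) (hQ.eval_ne_zero x))
    hge'
  refine ⟨h, g - symbolMul u ⟨f, h⟩, ?_, ?_⟩
  · rw [lax_apply, map_sub, ← hm, szego_coe]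
  · filter_upwards [hge', symbolMul_coeFn u ⟨f, h⟩, hf, Lp.coeFn_sub g (symbolMul u ⟨f, h⟩)]
      with x h1 h2 h3 h4
    rw [h4, Pi.sub_apply, h1, h2, h3]

theorem degree_mul_conjPoly {Q A B : ℂ[X]} (hQ : Q ≠ 0) (hA : A.degree < Q.degree)
    (hB : B.degree ≤ Q.degree) : (A * B).degree < (Q * conjPoly Q).degree := by
  rw [degree_mul (p := Q), degree_conjPoly, ← degree_mul]
  exact degree_mul_lt_sq hQ hA hB

end RatioSpace

/-! ### Invariant subspaces of the Lax operator -/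

/-- The eigenvectors of the Lax operator, together with zero. -/
def eigenvectors (u : L2) : Set hardy :=
  {φ : hardy | ∃ (μ : ℂ) (x : (lax u).domain), (x : hardy) = φ ∧ lax u x = μ • φ}

theorem mem_eigenvectors {u : L2} {φ : hardySobolev} {μ : ℂ} (h : lax u φ = μ • (φ : hardy)) :
    (φ : hardy) ∈ eigenvectors u := ⟨μ, φ, rfl, h⟩

theorem span_le_purePoint (u : L2) : Submodule.span ℂ (eigenvectors u) ≤ purePoint (lax u) :=
  Submodule.le_topologicalClosure _

/-- A subspace is contained in the domain of the Lax operator and invariant under it. -/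
def LaxInvariant (u : L2) (V : Submodule ℂ hardy) : Prop :=
  ∀ f ∈ V, ∃ h : f ∈ hardySobolev, lax u (⟨f, h⟩ : hardySobolev) ∈ V

theorem iSup_eigenspace_eq_top {E : Type*} [NormedAddCommGroup E] [InnerProductSpace ℂ E]
    {H : Submodule ℂ E} {V : Submodule ℂ H} [FiniteDimensional ℂ V] (T : V →ₗ[ℂ] V)
    (hT : ∀ f g : V, inner ℂ ((T f : H) : E) ((g : H) : E) =
      inner ℂ ((f : H) : E) ((T g : H) : E)) : (⨆ μ, Module.End.eigenspace T μ) = ⊤ := by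
  have hTs : LinearMap.IsSymmetric (𝕜 := ℂ) (E := V) T := hT
  have h := hTs.orthogonalComplement_iSup_eigenspaces_eq_bot
  exact (Submodule.orthogonal_eq_bot_iff (𝕜 := ℂ) (E := V)).1 h

/-- The restriction of the Lax operator to a finite-dimensional invariant subspace is symmetric, and
therefore diagonalizable. -/
theorem LaxInvariant.le_span {u : L2} (hu : ∀ᵐ x : ℝ, (u x).im = 0) {V : Submodule ℂ hardy}
    [FiniteDimensional ℂ V] (hV : LaxInvariant u V) :
    V ≤ Submodule.span ℂ (eigenvectors u) := by
  have hd : V ≤ (lax u).domain := fun f hf => (hV f hf).1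
  set T : V →ₗ[ℂ] V := LinearMap.codRestrict V ((lax u).toFun ∘ₗ Submodule.inclusion hd)
    (fun f => (hV f f.2).2) with hT
  have h1 : (⨆ μ, Module.End.eigenspace T μ) = ⊤ :=
    iSup_eigenspace_eq_top T fun f g => inner_lax hu ⟨f.1, hd f.2⟩ ⟨g.1, hd g.2⟩
  have h2 : V = (⨆ μ, Module.End.eigenspace T μ).map V.subtype := by
    rw [h1, Submodule.map_top, Submodule.range_subtype]
  rw [h2, Submodule.map_iSup]
  refine iSup_le fun μ => ?_
  rintro _ ⟨f, hf, rfl⟩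
  refine Submodule.subset_span ⟨μ, ⟨(f : hardy), hd f.2⟩, rfl, ?_⟩
  exact congrArg Subtype.val (Module.End.mem_eigenspace_iff.1 hf)

/-- If `(L - μ) φ` belongs to a finite-dimensional invariant subspace `V`, then the component of
`φ` orthogonal to `V` is an eigenvector. -/
theorem LaxInvariant.exists_decomposition {u : L2} (hu : ∀ᵐ x : ℝ, (u x).im = 0)
    {V : Submodule ℂ hardy} [FiniteDimensional ℂ V] (hV : LaxInvariant u V) {φ : hardySobolev}
    {μ : ℂ} (h : lax u φ - μ • (φ : hardy) ∈ V) :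
    ∃ b : hardySobolev, (φ : hardy) - b ∈ V ∧ (∀ v ∈ V, inner ℂ (v : L2) ((b : hardy) : L2) = 0) ∧
      lax u b = μ • (b : hardy) := by
  obtain ⟨a, ha, b, hb, hab⟩ := V.exists_add_mem_mem_orthogonal (φ : hardy)
  obtain ⟨haS, haL⟩ := hV a ha
  have hbe : b = (φ : hardy) - a := by rw [hab, add_sub_cancel_left]
  have hbS : b ∈ hardySobolev := by
    rw [hbe]
    exact hardySobolev.sub_mem φ.2 haS
  have horth : ∀ v ∈ V, inner ℂ (v : L2) (b : L2) = 0 := fun v hv =>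
    (Submodule.mem_orthogonal V b).1 hb v hv
  refine ⟨⟨b, hbS⟩, ?_, horth, ?_⟩
  · rw [hab, add_sub_cancel_right]
    exact ha
  · have h1 : (⟨b, hbS⟩ : hardySobolev) = φ - ⟨a, haS⟩ := Subtype.ext hbe
    have h2 : lax u (⟨b, hbS⟩ : hardySobolev) = lax u φ - lax u (⟨a, haS⟩ : hardySobolev) := by
      rw [h1]
      exact map_sub (lax u).toFun φ ⟨a, haS⟩
    have h3 : lax u (⟨b, hbS⟩ : hardySobolev) - μ • b ∈ V := by
      have h4 : lax u (⟨b, hbS⟩ : hardySobolev) - μ • b =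
          (lax u φ - μ • (φ : hardy)) - (lax u (⟨a, haS⟩ : hardySobolev) - μ • a) := by
        rw [h2, hbe, smul_sub]
        abel
      rw [h4]
      exact V.sub_mem h (V.sub_mem haL (V.smul_mem _ ha))
    have h5 : ∀ v ∈ V,
        inner ℂ (v : L2) ((lax u (⟨b, hbS⟩ : hardySobolev) - μ • b : hardy) : L2) = 0 := by
      intro v hv
      obtain ⟨hvS, hvL⟩ := hV v hv
      have h6 := inner_lax hu ⟨v, hvS⟩ ⟨b, hbS⟩
      have h7 := h6.symm.trans (horth _ hvL)
      rw [Submodule.coe_sub, inner_sub_right, h7, Submodule.coe_smul, inner_smul_right,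
        horth v hv, mul_zero]
      exact sub_zero _
    have h7 := h5 _ h3
    rw [inner_self_eq_zero] at h7
    exact sub_eq_zero.1 (Subtype.ext h7)

theorem MulRel.add {f₁ f₂ g₁ g₂ : L2} (h₁ : MulRel f₁ g₁) (h₂ : MulRel f₂ g₂) :
    MulRel (f₁ + f₂) (g₁ + g₂) := by
  obtain ⟨c₁, h₁⟩ := h₁
  obtain ⟨c₂, h₂⟩ := h₂
  refine ⟨c₁ + c₂, ?_⟩
  filter_upwards [h₁, h₂, Lp.coeFn_add f₁ f₂, Lp.coeFn_add g₁ g₂] with x h3 h4 h5 h6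
  rw [h5, h6, Pi.add_apply, Pi.add_apply, mul_add, h3, h4]
  ring

theorem MulRel.smul {f g : L2} (h : MulRel f g) (a : ℂ) : MulRel (a • f) (a • g) := by
  obtain ⟨c, h⟩ := h
  refine ⟨a * c, ?_⟩
  filter_upwards [h, Lp.coeFn_smul a f, Lp.coeFn_smul a g] with x h1 h2 h3
  rw [h2, h3, Pi.smul_apply, Pi.smul_apply, smul_eq_mul, smul_eq_mul, mul_left_comm, h1]
  ring

section PurePoint

open Polynomial

/-- A finite-dimensional subspace which is invariant under multiplication by `x` up to constants
is invariant under `G` and consists of the proper fractions whose denominator is the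
characteristic polynomial of `G`. -/
theorem exists_generator_ratioSpace {V : Submodule ℂ hardy} [FiniteDimensional ℂ V]
    (hV : ∀ f ∈ V, ∃ g ∈ V, MulRel (f : L2) (g : L2)) :
    ∃ (hd : V ≤ generator.domain) (hG : ∀ f : V, generator ⟨f, hd f.2⟩ ∈ V),
      IsStable (restrictTo generator V hd hG).charpoly ∧
      V = ratioSpace (restrictTo generator V hd hG).charpoly := by
  have hd : V ≤ generator.domain := fun f hf => by
    obtain ⟨g, -, h⟩ := hV f hf
    exact h.generator_eq.1
  have hrel : ∀ f : V, generator ⟨f, hd f.2⟩ ∈ V ∧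
      MulRel ((f : hardy) : L2) (generator ⟨f, hd f.2⟩ : L2) := fun f => by
    obtain ⟨g, hg, h⟩ := hV f f.2
    obtain ⟨h1, h2⟩ := h.generator_eq
    rw [h2]
    exact ⟨hg, h⟩
  have hG : ∀ f : V, generator ⟨f, hd f.2⟩ ∈ V := fun f => (hrel f).1
  have hM : ∀ f : V, MulRel (f : hardy) (restrictTo generator V hd hG f : hardy) :=
    fun f => (hrel f).2
  have hstable := isStable_charpoly hM
  refine ⟨hd, hG, hstable, ?_⟩
  have := finiteDimensional_ratioSpace hstable
  refine Submodule.eq_of_le_of_finrank_eq (fun f hf => ?_) ?_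
  · obtain ⟨R, hR, h⟩ := exists_charpoly_mul_eq hM ⟨f, hf⟩
    refine ⟨R, by rwa [LinearMap.charpoly_natDegree], ?_⟩
    filter_upwards [h] with x h1
    rw [← h1, mul_div_cancel_left₀ _ (hstable.eval_ne_zero x)]
  · rw [finrank_ratioSpace hstable, LinearMap.charpoly_natDegree]

/-- If the space of proper fractions with denominator `Q` is invariant under the Lax operator and
contains `Π u`, then `Π u = i Q' / Q`: apply the Lax operator to `1 / Q` and compare the terms with
denominator `Q²`. -/
theorem szego_eq_of_laxInvariant {u : L2} (hu : ∀ᵐ x : ℝ, (u x).im = 0) {Q : ℂ[X]}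
    (hQ : IsStable Q) (hQ0 : 0 < Q.natDegree) (hV : LaxInvariant u (ratioSpace Q))
    (hw : szego u ∈ ratioSpace Q) : ((szego u : L2) : ℝ → ℂ) =ᵐ[volume]
      fun x => Complex.I * Q.derivative.eval (x : ℂ) / Q.eval (x : ℂ) := by
  obtain ⟨P, hP, hwe⟩ := hw
  have hP' := degree_lt_of_mem hQ.1 hP
  have h1mem : (1 : ℂ[X]) ∈ degreeLT ℂ Q.natDegree := by
    rw [mem_degreeLT, degree_one]
    exact_mod_cast hQ0
  obtain ⟨f, hf, hfe⟩ := exists_mem_ratioSpace hQ h1mem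
  obtain ⟨hfS, d, hd, hde⟩ := exists_lax_ratio hQ u h1mem hfe
  obtain ⟨_, B, hB, hBe⟩ := hV f hf
  rw [hd] at hBe
  set D : ℂ[X] := Complex.I • Q.derivative - P with hD
  have hDdeg : D.degree < Q.degree := (degree_sub_le _ _).trans_lt
    (max_lt ((degree_smul_le _ _).trans_lt (degree_derivative_lt hQ.1)) hP')
  have hDQ : D.degree < (Q * Q).degree := by
    rw [← mul_one D]
    exact degree_mul_lt_sq hQ.1 hDdeg (by
      rw [degree_one, degree_eq_natDegree hQ.1]
      exact_mod_cast hQ0.le)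
  obtain ⟨k, hk, hke⟩ := exists_hardy_ratio (hQ.mul hQ) hDQ
  have hPc : (conjPoly P).degree < (Q * conjPoly Q).degree := by
    rw [← mul_one (conjPoly P)]
    refine degree_mul_conjPoly hQ.1 (by rwa [degree_conjPoly]) (by
      rw [degree_one, degree_eq_natDegree hQ.1]
      exact_mod_cast hQ0.le)
  -- `L (1 / Q)` is the sum of `(i Q' - P) / Q²` and of a fraction with denominator `Q`
  have hdk : ∀ᵐ x : ℝ, (k - d) x =
      (conjPoly P).eval (x : ℂ) / (Q * conjPoly Q).eval (x : ℂ) := by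
    have hus := eq_szego_add_star hu
    have hue : ∀ᵐ x : ℝ, u x = (szego u : L2) x + star ((szego u : L2) x) := by
      filter_upwards [Lp.coeFn_add (szego u : L2) (star (szego u : L2)),
        Lp.coeFn_star (szego u : L2)] with x h1 h2
      conv_lhs => rw [hus]
      rw [h1, Pi.add_apply, h2, Pi.star_apply]
    filter_upwards [hde, hke, hue, hwe, Lp.coeFn_sub k d] with x h1 h2 h3 h4 h5
    have h6 := hQ.eval_ne_zero x
    have h7 : starRingEnd ℂ (Q.eval (x : ℂ)) ≠ 0 := by rwa [Ne, map_eq_zero]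
    rw [h5, Pi.sub_apply, h1, h2, h3, h4, eval_mul, eval_mul, eval_conjPoly_ofReal,
      eval_conjPoly_ofReal, Complex.star_def, map_div₀, hD, eval_sub, eval_smul, derivative_one,
      eval_zero, eval_one, smul_eq_mul]
    field_simp
    ring
  obtain ⟨A, hA, hAe⟩ := szego_ratio hQ hPc hdk
  rw [map_sub, szego_coe ⟨k, hk⟩] at hAe
  have hDeq : D = (A + B) * Q := by
    apply polynomial_eq_of_ae_eq
    filter_upwards [hke, hAe, hBe, Lp.coeFn_sub k (szego d : L2)] with x h1 h2 h3 h4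
    rw [Submodule.coe_sub] at h2
    rw [h4, Pi.sub_apply, h1, h3, eval_mul] at h2
    have h5 := hQ.eval_ne_zero x
    rw [eval_mul, eval_add]
    field_simp at h2
    linear_combination h2
  have hD0 : D = 0 := by
    by_contra h0
    rw [hDeq] at h0
    rw [hDeq, degree_mul] at hDdeg
    have h2 : A + B ≠ 0 := left_ne_zero_of_mul h0
    rw [degree_eq_natDegree h2, degree_eq_natDegree hQ.1] at hDdeg
    norm_cast at hDdeg
    omega
  have hP0 : P = Complex.I • Q.derivative := (sub_eq_zero.1 (hD.symm.trans hD0)).symm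
  filter_upwards [hwe] with x h1
  rw [h1, hP0, eval_smul, smul_eq_mul]

end PurePoint

/-! ### The pure point subspace -/

theorem MulRel.zero : MulRel 0 0 := by
  refine ⟨0, ?_⟩
  filter_upwards [Lp.coeFn_zero ℂ 2 (volume : Measure ℝ)] with x hx
  rw [hx]
  simp

theorem purePoint_eq_span {u : L2} [FiniteDimensional ℂ (purePoint (lax u))] :
    purePoint (lax u) = Submodule.span ℂ (eigenvectors u) := by
  have : FiniteDimensional ℂ (Submodule.span ℂ (eigenvectors u)) :=
    Submodule.finiteDimensional_of_le (span_le_purePoint u)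
  exact (Submodule.closed_of_finiteDimensional
    (Submodule.span ℂ (eigenvectors u))).submodule_topologicalClosure_eq

theorem lax_smul (u : L2) (a : ℂ) (f : hardySobolev) : lax u (a • f) = a • lax u f :=
  LinearMap.map_smul (lax u).toFun a f

theorem lax_add (u : L2) (f g : hardySobolev) : lax u (f + g) = lax u f + lax u g :=
  LinearMap.map_add (lax u).toFun f g

theorem laxInvariant_span (u : L2) : LaxInvariant u (Submodule.span ℂ (eigenvectors u)) := by
  intro f hf
  induction hf using Submodule.span_induction with
  | mem f hf =>
    obtain ⟨μ, x, rfl, hx⟩ := hf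
    refine ⟨x.2, ?_⟩
    have h : lax u (⟨(x : hardy), x.2⟩ : hardySobolev) = μ • (x : hardy) := hx
    rw [h]
    exact Submodule.smul_mem _ _ (Submodule.subset_span ⟨μ, x, rfl, hx⟩)
  | zero =>
    refine ⟨hardySobolev.zero_mem, ?_⟩
    have h : lax u (⟨0, hardySobolev.zero_mem⟩ : hardySobolev) = 0 := map_zero (lax u).toFun
    rw [h]
    exact Submodule.zero_mem _
  | add f g _ _ hf hg =>
    obtain ⟨hf1, hf2⟩ := hf
    obtain ⟨hg1, hg2⟩ := hg
    refine ⟨hardySobolev.add_mem hf1 hg1, ?_⟩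
    have h : (⟨f + g, hardySobolev.add_mem hf1 hg1⟩ : hardySobolev) =
        (⟨f, hf1⟩ : hardySobolev) + (⟨g, hg1⟩ : hardySobolev) := rfl
    rw [h, lax_add]
    exact Submodule.add_mem _ hf2 hg2
  | smul a f _ hf =>
    obtain ⟨hf1, hf2⟩ := hf
    refine ⟨hardySobolev.smul_mem a hf1, ?_⟩
    have h : (⟨a • f, hardySobolev.smul_mem a hf1⟩ : hardySobolev) =
        a • (⟨f, hf1⟩ : hardySobolev) := rfl
    rw [h, lax_smul]
    exact Submodule.smul_mem _ _ hf2

/-- If the pure point subspace is finite-dimensional and contains `Π u`, then multiplication by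
`x` preserves it up to constants. Indeed, for an eigenvector `φ` with eigenvalue `l`, the function
`g = x φ - c` satisfies `(L - l) g ∈ H_pp`, so that the component of `g` orthogonal to `H_pp` is an
eigenvector, hence vanishes. -/
theorem exists_mulRel_purePoint {u : L2} (hu : ∀ᵐ x : ℝ, (u x).im = 0)
    (hxu : MemLp (fun x : ℝ => (x : ℂ) * u x) 2 volume)
    [FiniteDimensional ℂ (purePoint (lax u))] (hw : szego u ∈ purePoint (lax u)) :
    ∀ f ∈ purePoint (lax u), ∃ g ∈ purePoint (lax u), MulRel (f : L2) (g : L2) := by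
  have hV : LaxInvariant u (purePoint (lax u)) := by
    rw [purePoint_eq_span]
    exact laxInvariant_span u
  intro f hf
  rw [purePoint_eq_span] at hf
  induction hf using Submodule.span_induction with
  | mem f hf =>
    obtain ⟨μ, φ, rfl, hφ⟩ := hf
    change lax u (φ : hardySobolev) = μ • ((φ : hardySobolev) : hardy) at hφ
    by_cases h0 : φ = 0
    · refine ⟨0, Submodule.zero_mem _, ?_⟩
      rw [h0]
      exact MulRel.zero
    have hμ := eigenvalue_real hu hφ h0
    rw [← hμ] at hφ
    have hneg : μ.re < 0 := by
      by_contra hn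
      exact h0 (eigenfunction_eq_zero hu hxu hφ (Or.inl (not_lt.1 hn)))
    obtain ⟨g, c, hg, hLg⟩ := exists_mulRel_eigenfunction hxu hφ hneg
    have hφV : (φ : hardy) ∈ purePoint (lax u) :=
      span_le_purePoint u (Submodule.subset_span (mem_eigenvectors hφ))
    have hmem : lax u g - (μ.re : ℂ) • (g : hardy) ∈ purePoint (lax u) := by
      have h1 : lax u g - (μ.re : ℂ) • (g : hardy) =
          c • szego u - Complex.I • (φ : hardy) := by
        rw [hLg]
        abel
      rw [h1]
      exact Submodule.sub_mem _ (Submodule.smul_mem _ _ hw) (Submodule.smul_mem _ _ hφV)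
    obtain ⟨b, hgb, hb, hLb⟩ := hV.exists_decomposition hu hmem
    have hb0 := hb _ (span_le_purePoint u (Submodule.subset_span (mem_eigenvectors hLb)))
    rw [inner_self_eq_zero] at hb0
    have hb1 : (b : hardy) = 0 := Subtype.ext hb0
    rw [hb1, sub_zero] at hgb
    exact ⟨g, hgb, hg⟩
  | zero => exact ⟨0, Submodule.zero_mem _, MulRel.zero⟩
  | add f₁ f₂ _ _ h₁ h₂ =>
    obtain ⟨g₁, hg₁, h₁⟩ := h₁
    obtain ⟨g₂, hg₂, h₂⟩ := h₂
    exact ⟨g₁ + g₂, Submodule.add_mem _ hg₁ hg₂, h₁.add h₂⟩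
  | smul a f _ h =>
    obtain ⟨g, hg, h⟩ := h
    exact ⟨a • g, Submodule.smul_mem _ _ hg, h.smul a⟩

open Polynomial in
/-- The inverse spectral formula: `Π u = i Q' / Q`, where `Q` is the characteristic polynomial of
`G` on the pure point subspace. -/
theorem exists_generator_purePoint {u : L2} (hu : ∀ᵐ x : ℝ, (u x).im = 0)
    (hxu : MemLp (fun x : ℝ => (x : ℂ) * u x) 2 volume)
    (hpos : 0 < Module.finrank ℂ (purePoint (lax u))) [FiniteDimensional ℂ (purePoint (lax u))]
    (hw : szego u ∈ purePoint (lax u)) :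
    ∃ (hd : purePoint (lax u) ≤ generator.domain)
      (hG : ∀ f : purePoint (lax u), generator ⟨f, hd f.2⟩ ∈ purePoint (lax u)),
      IsStable (restrictTo generator _ hd hG).charpoly ∧
      ((szego u : L2) : ℝ → ℂ) =ᵐ[volume] fun x => Complex.I *
        (restrictTo generator _ hd hG).charpoly.derivative.eval (x : ℂ) /
        (restrictTo generator _ hd hG).charpoly.eval (x : ℂ) := by
  obtain ⟨hd, hG, hQ, hV⟩ := exists_generator_ratioSpace (exists_mulRel_purePoint hu hxu hw)
  refine ⟨hd, hG, hQ, szego_eq_of_laxInvariant hu hQ ?_ ?_ ?_⟩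
  · rwa [LinearMap.charpoly_natDegree]
  · rw [← hV, purePoint_eq_span]
    exact laxInvariant_span u
  · rwa [← hV]

/-! ### Square integrability with weight -/

theorem memLp_weightedMeasure_iff (u : L2) : MemLp u 2 weightedMeasure ↔
    MemLp (fun x : ℝ => (x : ℂ) * u x) 2 volume := by
  have hu := Lp.memLp u
  have hum := Lp.aestronglyMeasurable u
  have hac : weightedMeasure ≪ volume := withDensity_absolutelyContinuous _ _
  have hu2 := (memLp_two_iff_integrable_sq_norm hum).1 hu
  have hxm : AEStronglyMeasurable (fun x : ℝ => (x : ℂ) * u x) volume :=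
    (Complex.continuous_ofReal.aestronglyMeasurable).mul hum
  rw [memLp_two_iff_integrable_sq_norm (hum.mono_ac hac), memLp_two_iff_integrable_sq_norm hxm,
    weightedMeasure, integrable_withDensity_iff_integrable_smul' (by fun_prop)
      (.of_forall fun x => ENNReal.ofReal_lt_top)]
  have h (x : ℝ) : (ENNReal.ofReal (1 + x ^ 2)).toReal • ‖u x‖ ^ 2 =
      ‖u x‖ ^ 2 + ‖(x : ℂ) * u x‖ ^ 2 := by
    rw [ENNReal.toReal_ofReal (by positivity), norm_mul, Complex.norm_real, Real.norm_eq_abs,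
      mul_pow, sq_abs, smul_eq_mul]
    ring
  simp_rw [h]
  exact integrable_add_iff_integrable_right hu2

/-! ### Solitons and their Hardy components -/

section Soliton

open Polynomial

/-- A soliton is twice the real part of a simple fraction with pole in the lower half-plane. -/
theorem scaledProfile_eq {c : ℝ} (hc : 0 < c) (y x : ℝ) : ((scaledProfile c (x - y) : ℝ) : ℂ) =
    Complex.I / (x - (y - Complex.I / c)) +
      starRingEnd ℂ (Complex.I / (x - (y - Complex.I / c))) := by
  have hc' : (c : ℂ) ≠ 0 := by exact_mod_cast hc.ne'
  have h1 : (1 + c ^ 2 * (x - y) ^ 2 : ℂ) ≠ 0 := by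
    have : (0 : ℝ) < 1 + c ^ 2 * (x - y) ^ 2 := by positivity
    exact_mod_cast this.ne'
  have h2 : (1 + c ^ 2 * (x - y) ^ 2 : ℂ) =
      c ^ 2 * ((x - (y - Complex.I / c)) * (x - (y + Complex.I / c))) := by
    field_simp
    linear_combination Complex.I_sq
  have h3 : (x - (y - Complex.I / c) : ℂ) ≠ 0 := by
    intro h
    rw [h2, h, zero_mul, mul_zero] at h1
    exact h1 rfl
  have h4 : (x - (y + Complex.I / c) : ℂ) ≠ 0 := by
    intro h
    rw [h2, h, mul_zero, mul_zero] at h1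
    exact h1 rfl
  have h5 : starRingEnd ℂ (Complex.I / (x - (y - Complex.I / c))) =
      -Complex.I / (x - (y + Complex.I / c)) := by
    simp only [map_div₀, map_sub, Complex.conj_I, Complex.conj_ofReal]
    congr 1
    ring
  rw [h5, scaledProfile, profile]
  push_cast
  rw [mul_pow, h2]
  have h6 : Complex.I / (x - (y - Complex.I / c) : ℂ) + -Complex.I / (x - (y + Complex.I / c)) =
      2 / c / ((x - (y - Complex.I / c)) * (x - (y + Complex.I / c))) := by
    rw [div_add_div _ _ h3 h4]
    congr 1
    linear_combination (-2 / (c : ℂ)) * Complex.I_sq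
  rw [h6]
  field_simp

theorem soliton_pole_im_neg {c : ℝ} (hc : 0 < c) (y : ℝ) : (y - Complex.I / c : ℂ).im < 0 := by
  rw [Complex.sub_im, Complex.div_ofReal_im, Complex.I_im, Complex.ofReal_im, zero_sub,
    neg_lt_zero]
  exact one_div_pos.2 hc

theorem logDeriv_eval_eq_sum {N : ℕ} {Q : ℂ[X]} {p : Fin N → ℂ}
    (hp : Q.roots = Finset.univ.val.map p) {x : ℂ} (hx : Q.eval x ≠ 0) :
    Complex.I * Q.derivative.eval x / Q.eval x = ∑ j, Complex.I / (x - p j) := by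
  rw [mul_div_assoc, (IsAlgClosed.splits Q).eval_derivative_div_eval_of_ne_zero hx, hp,
    Multiset.map_map]
  simp only [Function.comp_def]
  rw [← Finset.sum_eq_multiset_sum, Finset.mul_sum]
  exact Finset.sum_congr rfl fun j _ => by ring

/-- The solitons are the functions `w + w̄` with `w = i Q' / Q`, for a monic polynomial `Q` of
degree `N` with all of its roots in the lower half-plane. -/
theorem mem_multiSolitons_iff {N : ℕ} {u : L2} : u ∈ multiSolitons N ↔
    ∃ Q : ℂ[X], IsStable Q ∧ Q.Monic ∧ Q.natDegree = N ∧ ∀ᵐ x : ℝ,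
      u x = Complex.I * Q.derivative.eval (x : ℂ) / Q.eval (x : ℂ) +
        starRingEnd ℂ (Complex.I * Q.derivative.eval (x : ℂ) / Q.eval (x : ℂ)) := by
  constructor
  · rintro ⟨c, y, hc, hu⟩
    set p : Fin N → ℂ := fun j => y j - Complex.I / c j with hp
    have hroots : (∏ j, (X - C (p j))).roots = Finset.univ.val.map p := by
      have h := roots_multiset_prod_X_sub_C (Finset.univ.val.map p)
      rwa [Multiset.map_map] at h
    have hm : (∏ j, (X - C (p j))).Monic := monic_prod_X_sub_C _ _
    have hQ : IsStable (∏ j, (X - C (p j))) := by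
      refine ⟨hm.ne_zero, fun z hz => ?_⟩
      rw [eval_prod, Finset.prod_eq_zero_iff] at hz
      obtain ⟨j, -, hj⟩ := hz
      rw [eval_sub, eval_X, eval_C, sub_eq_zero] at hj
      rw [hj, hp]
      exact soliton_pole_im_neg (hc j) (y j)
    refine ⟨_, hQ, hm, by simp, ?_⟩
    filter_upwards [hu] with x hx
    rw [hx, logDeriv_eval_eq_sum hroots (hQ.eval_ne_zero x), map_sum, ← Finset.sum_add_distrib]
    push_cast
    exact Finset.sum_congr rfl fun j _ => scaledProfile_eq (hc j) (y j) x
  · rintro ⟨Q, hQ, hm, hN, hu⟩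
    have hcard : Q.roots.toList.length = N := by
      rw [Multiset.length_toList, ← (IsAlgClosed.splits Q).natDegree_eq_card_roots, hN]
    subst hcard
    set p : Fin Q.roots.toList.length → ℂ := Q.roots.toList.get with hp
    have hroots : Q.roots = Finset.univ.val.map p := by
      rw [Fin.univ_val_map, hp, List.ofFn_get, Multiset.coe_toList]
    have hpim (j) : (p j).im < 0 := by
      have h1 : p j ∈ Q.roots := by
        rw [hroots]
        exact Multiset.mem_map_of_mem p (Finset.mem_univ j)
      exact hQ.2 _ (isRoot_of_mem_roots h1)
    refine ⟨fun j => (-(p j).im)⁻¹, fun j => (p j).re, fun j => inv_pos.2 (neg_pos.2 (hpim j)), ?_⟩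
    filter_upwards [hu] with x hx
    rw [hx, logDeriv_eval_eq_sum hroots (hQ.eval_ne_zero x), map_sum, ← Finset.sum_add_distrib]
    push_cast
    refine Finset.sum_congr rfl fun j _ => ?_
    have h1 : ((p j).re - Complex.I / (((-(p j).im)⁻¹ : ℝ) : ℂ) : ℂ) = p j := by
      push_cast
      rw [div_inv_eq_mul]
      conv_rhs => rw [← Complex.re_add_im (p j)]
      ring
    rw [scaledProfile_eq (inv_pos.2 (neg_pos.2 (hpim j))), h1]

/-- Multiplication by `x` maps solitons to square integrable functions: the constants in
`x i / (x - p) = i + i p / (x - p)` and in its conjugate cancel. -/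
theorem memLp_mul_of_mem_multiSolitons {N : ℕ} {u : L2} (hu : u ∈ multiSolitons N) :
    MemLp (fun x : ℝ => (x : ℂ) * u x) 2 volume := by
  obtain ⟨c, y, hc, hu⟩ := hu
  have hp (j) := soliton_pole_im_neg (hc j) (y j)
  have hmem : ∀ j ∈ Finset.univ, MemLp (fun x : ℝ =>
      (x : ℂ) * ((scaledProfile (c j) (x - y j) : ℝ) : ℂ)) 2 volume := by
    intro j _
    set p : ℂ := y j - Complex.I / (c j : ℂ) with hpj
    obtain ⟨f, -, hf⟩ := inv_sub_mem_hardy (hp j)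
    have h1 := ((Lp.memLp f).const_mul (Complex.I * p)).add
      ((Lp.memLp (star f)).const_mul (starRingEnd ℂ (Complex.I * p)))
    refine (memLp_congr_ae ?_).1 h1
    filter_upwards [hf, Lp.coeFn_star f] with x h2 h3
    have h4 : (x : ℂ) - p ≠ 0 := ofReal_sub_ne_zero (hp j).ne x
    have h5 : (x : ℂ) - starRingEnd ℂ p ≠ 0 := by
      have := (map_ne_zero (starRingEnd ℂ)).2 h4
      rwa [map_sub, Complex.conj_ofReal] at this
    rw [Pi.add_apply, h3, Pi.star_apply, h2, scaledProfile_eq (hc j), ← hpj, Complex.star_def]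
    simp only [map_inv₀, map_sub, map_mul, map_div₀, Complex.conj_ofReal, Complex.conj_I]
    field_simp
    ring
  refine (memLp_congr_ae ?_).1 (memLp_finsetSum _ hmem)
  filter_upwards [hu] with x hx
  rw [hx, ← Finset.mul_sum]
  push_cast
  rfl

end Soliton

/-! ### The pure point subspace of a soliton -/

section Spectral

open Polynomial

theorem szego_eq_of_real_part {u : L2} {w : hardy}
    (hu : ∀ᵐ x : ℝ, u x = (w : L2) x + starRingEnd ℂ ((w : L2) x)) : szego u = w := by
  have h : u = (w : L2) + star (w : L2) := by
    apply Lp.ext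
    filter_upwards [hu, Lp.coeFn_add (w : L2) (star (w : L2)), Lp.coeFn_star (w : L2)]
      with x h1 h2 h3
    rw [h1, h2, Pi.add_apply, h3, Pi.star_apply, Complex.star_def]
  rw [h, map_add, szego_coe, szego_star, add_zero]

/-- If `u` is twice the real part of `i Q' / Q`, then the Lax operator preserves the proper
fractions with denominator `Q`: the terms with denominator `Q²` cancel. -/
theorem laxInvariant_ratioSpace {u : L2} {Q : ℂ[X]} (hQ : IsStable Q)
    (hu : ∀ᵐ x : ℝ, u x = Complex.I * Q.derivative.eval (x : ℂ) / Q.eval (x : ℂ) +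
      starRingEnd ℂ (Complex.I * Q.derivative.eval (x : ℂ) / Q.eval (x : ℂ))) :
    LaxInvariant u (ratioSpace Q) := by
  rintro f ⟨A, hA, hf⟩
  obtain ⟨hfS, d, hd, hde⟩ := exists_lax_ratio hQ u hA hf
  refine ⟨hfS, ?_⟩
  have hA' := degree_lt_of_mem hQ.1 hA
  set D : ℂ[X] := Complex.I • (A * conjPoly Q.derivative - A.derivative * conjPoly Q) with hD
  have hdeg : D.degree < (Q * conjPoly Q).degree := by
    refine (degree_smul_le _ _).trans_lt ((degree_sub_le _ _).trans_lt (max_lt ?_ ?_))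
    · exact degree_mul_conjPoly hQ.1 hA' (by
        rw [degree_conjPoly]
        exact degree_derivative_le)
    · exact degree_mul_conjPoly hQ.1 (degree_derivative_le.trans_lt hA') (degree_conjPoly Q).le
  have hdD : ∀ᵐ x : ℝ, d x = D.eval (x : ℂ) / (Q * conjPoly Q).eval (x : ℂ) := by
    filter_upwards [hde, hu] with x h1 h2
    have h3 := hQ.eval_ne_zero x
    have h4 : starRingEnd ℂ (Q.eval (x : ℂ)) ≠ 0 := (_root_.map_ne_zero _).2 h3
    rw [h1, h2, hD, eval_smul, eval_sub, eval_mul, eval_mul, eval_mul, eval_conjPoly_ofReal,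
      eval_conjPoly_ofReal, map_div₀, map_mul, Complex.conj_I, smul_eq_mul]
    field_simp
    ring
  obtain ⟨B, hB, hBe⟩ := szego_ratio hQ hdeg hdD
  rw [hd]
  exact ⟨B, mem_of_degree_lt hB, hBe⟩

/-- If the invariant subspace `V` contains `Π u`, then every eigenvector belongs to `V`: the
component `b` orthogonal to `V` is an eigenvector with `∫ u b = 0`. -/
theorem LaxInvariant.purePoint_eq {u : L2} (hu : ∀ᵐ x : ℝ, (u x).im = 0)
    (hxu : MemLp (fun x : ℝ => (x : ℂ) * u x) 2 volume) {V : Submodule ℂ hardy}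
    [FiniteDimensional ℂ V] (hV : LaxInvariant u V) (hw : szego u ∈ V) :
    purePoint (lax u) = V := by
  refine le_antisymm ?_ ((hV.le_span hu).trans (span_le_purePoint u))
  refine Submodule.topologicalClosure_minimal _ (Submodule.span_le.2 ?_)
    (Submodule.closed_of_finiteDimensional V)
  rintro _ ⟨μ, φ, rfl, hφ⟩
  change lax u (φ : hardySobolev) = μ • ((φ : hardySobolev) : hardy) at hφ
  obtain ⟨b, hb, horth, hLb⟩ := hV.exists_decomposition hu (φ := φ) (μ := μ) (by
    rw [hφ, sub_self]
    exact V.zero_mem)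
  have hint : ∫ x, u x * ((b : hardy) : L2) x = 0 := by
    rw [← horth _ hw, inner_szego_left, L2.inner_def]
    refine integral_congr_ae ?_
    filter_upwards [hu] with x hx
    rw [RCLike.inner_apply, Complex.conj_eq_iff_im.2 hx, mul_comm]
  have hb0 : b = 0 := by
    by_contra h0
    have hμ := eigenvalue_real hu hLb h0
    rw [← hμ] at hLb
    exact h0 (eigenfunction_eq_zero hu hxu hLb (Or.inr hint))
  rw [hb0, Submodule.coe_zero, sub_zero] at hb
  exact hb

theorem spectral_of_mem_multiSolitons {N : ℕ} {u : L2} (hu : u ∈ multiSolitons N) :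
    (∀ᵐ x : ℝ, (u x).im = 0) ∧ Module.finrank ℂ (purePoint (lax u)) = N ∧
      FiniteDimensional ℂ (purePoint (lax u)) ∧ szego u ∈ purePoint (lax u) := by
  have hxu := memLp_mul_of_mem_multiSolitons hu
  have him : ∀ᵐ x : ℝ, (u x).im = 0 := by
    obtain ⟨c, y, -, hu⟩ := hu
    filter_upwards [hu] with x hx
    rw [hx, Complex.ofReal_im]
  obtain ⟨Q, hQ, -, hN, hue⟩ := mem_multiSolitons_iff.1 hu
  have hdeg : (Complex.I • Q.derivative).degree < Q.degree :=
    (degree_smul_le _ _).trans_lt (degree_derivative_lt hQ.1)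
  obtain ⟨w, hw, hwe⟩ := exists_mem_ratioSpace hQ (mem_of_degree_lt hdeg)
  have hsw : szego u = w := by
    apply szego_eq_of_real_part
    filter_upwards [hue, hwe] with x h1 h2
    rw [h1, h2, eval_smul, smul_eq_mul]
  have := finiteDimensional_ratioSpace hQ
  have hV := (laxInvariant_ratioSpace hQ hue).purePoint_eq him hxu (by rwa [hsw])
  rw [hV, hsw, finrank_ratioSpace hQ]
  exact ⟨him, hN, this, hw⟩

end Spectral

end BenjaminOno

theorem mainTheorem3 (N : ℕ) (hN : 0 < N) (u : BenjaminOno.L2) :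
    (u ∈ BenjaminOno.multiSolitons N ↔
      MemLp u 2 BenjaminOno.weightedMeasure ∧
      (∀ᵐ x : ℝ, (u x).im = 0) ∧
      Module.finrank ℂ (BenjaminOno.purePoint (BenjaminOno.lax u)) = N ∧
      BenjaminOno.szego u ∈ BenjaminOno.purePoint (BenjaminOno.lax u)) ∧
    (u ∈ BenjaminOno.multiSolitons N →
      ∃ (hd : BenjaminOno.purePoint (BenjaminOno.lax u) ≤ BenjaminOno.generator.domain)
        (hG : ∀ f : BenjaminOno.purePoint (BenjaminOno.lax u),
          BenjaminOno.generator ⟨f, hd f.2⟩ ∈ BenjaminOno.purePoint (BenjaminOno.lax u))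
        (Q : ℝ → ℂ),
        (∀ x : ℝ, Q x = LinearMap.det ((x : ℂ) • LinearMap.id -
          BenjaminOno.restrictTo BenjaminOno.generator
            (BenjaminOno.purePoint (BenjaminOno.lax u)) hd hG)) ∧
        (∀ x : ℝ, Q x ≠ 0) ∧
        ((BenjaminOno.szego u : BenjaminOno.L2) : ℝ → ℂ) =ᵐ[volume]
          fun x => Complex.I * deriv Q x / Q x) := by
  refine ⟨⟨fun hu => ?_, ?_⟩, fun hu => ?_⟩
  · obtain ⟨him, hrank, -, hw⟩ := BenjaminOno.spectral_of_mem_multiSolitons hu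
    exact ⟨(BenjaminOno.memLp_weightedMeasure_iff u).2
      (BenjaminOno.memLp_mul_of_mem_multiSolitons hu), him, hrank, hw⟩
  · rintro ⟨hmem, him, hrank, hw⟩
    have hpos : 0 < Module.finrank ℂ (BenjaminOno.purePoint (BenjaminOno.lax u)) := hrank ▸ hN
    have := Module.finite_of_finrank_pos hpos
    obtain ⟨hd, hG, hQ, hwe⟩ := BenjaminOno.exists_generator_purePoint him
      ((BenjaminOno.memLp_weightedMeasure_iff u).1 hmem) hpos hw
    refine BenjaminOno.mem_multiSolitons_iff.2 ⟨_, hQ, LinearMap.charpoly_monic _,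
      by rw [LinearMap.charpoly_natDegree, hrank], ?_⟩
    filter_upwards [hwe, Lp.coeFn_star (BenjaminOno.szego u : BenjaminOno.L2),
      Lp.coeFn_add (BenjaminOno.szego u : BenjaminOno.L2)
        (star (BenjaminOno.szego u : BenjaminOno.L2))] with x h1 h2 h3
    rw [← h1]
    conv_lhs => rw [BenjaminOno.eq_szego_add_star him]
    rw [h3, Pi.add_apply, h2, Pi.star_apply, Complex.star_def]
  · obtain ⟨him, hrank, _, hw⟩ := BenjaminOno.spectral_of_mem_multiSolitons hu
    obtain ⟨hd, hG, hQ, hwe⟩ := BenjaminOno.exists_generator_purePoint him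
      (BenjaminOno.memLp_mul_of_mem_multiSolitons hu) (hrank ▸ hN) hw
    refine ⟨hd, hG, fun x => (BenjaminOno.restrictTo BenjaminOno.generator _ hd hG).charpoly.eval
      (x : ℂ), fun x => ?_, hQ.eval_ne_zero, ?_⟩
    · refine (LinearMap.eval_charpoly _ _).trans ?_
      rfl
    · filter_upwards [hwe] with x h
      rw [h, (BenjaminOno.hasDerivAt_eval_ofReal _ x).deriv]
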